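/- Let $(X,\omega)$ be the double heptagon: the translation surface obtained from two regular heptagons with unit sides, one having a horizontal bottom side and the other being its image under rotation by $\pi$, by identifying each side of the one with the parallel side of the other by a translation. All vertices become one point, the cone point. Let $\Lambda\subset\mathbb{R}^2$ be the set of holonomy vectors of oriented saddle connections of $(X,\omega)$, that is, of straight segments on $X$ which run from the cone point to itself without meeting it in between. Put $x_0=\cos\frac{\pi}{7}$, $y_0=\sin\frac{\pi}{7}$, $\alpha=2\cot\frac{\pi}{7}$, and $$\Omega=\Big\{(a,b): 0<b\le 1,\ \tfrac{x_0}{y_0}b-\tfrac1{y_0}\le a<\big(\tfrac{x_0}{y_0}+\alpha\big)b-\tfrac1{y_0}\Big\},\qquad A^L=\Big(\tfrac{x_0-1}{y_0},\ \tfrac{x_0-1}{y_0}+\alpha\Big].$$ For $(a,b)\in\Omega$ let $M_{b,-a}=\begin{pmatrix} b&-a\\0&1/b\end{pmatrix}$. A vector $v\in\Lambda$ is the winning vector at $(a,b)$ if, among the vectors of $M_{b,-a}\Lambda$ of positive slope with $x$-component in $(0,1]$, $M_{b,-a}v$ is one of least slope, and the shortest one of that slope. For $a\in A^L$, a vector $(x,y)\in\Lambda$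 is a candidate left winning vector at $a$ if $y>0$ and $0\le x-ay<1$; the left winner at $a$ is the candidate of least slope (the shortest one, if there are several), where for vectors with $y>0$ smaller slope means larger $x/y$. Let $W^L(v)\subseteq A^L$ be the set of points at which $v\in\Lambda$ is the left winner. Let $$\begin{array}{ll} a_1=\dfrac{3\cos\frac{\pi}{7}-1}{\sin\frac{\pi}{7}}, & w_1=\big(2+3\cos\frac{2\pi}{7},\ \sin\frac{2\pi}{7}\big),\\[2mm] a_2=\dfrac{1+3\cos\frac{2\pi}{7}}{\sin\frac{2\pi}{7}}, & w_2=\big(4\cos\frac{\pi}{7}+3\cos\frac{3\pi}{7},\ \sin\frac{3\pi}{7}\big),\\[2mm] a_3=\dfrac{4\cos\frac{\pi}{7}+3\cos\frac{3\pi}{7}-1}{\sin\frac{3\pi}{7}}, & w_3=\big(4\cos\frac{\pi}{7}+\cos\frac{3\pi}{7},\ \sin\frac{3\pi}{7}\big),\\[2mm] a_4=\dfrac{4\cos\frac{\pi}{7}+\cos\frac{3\pi}{7}-1}{\sin\frac{3\pi}{7}}, & w_4=\big(2+\cos\frac{2\pi}{7},\ \sin\frac{2\pi}{7}\big),\\[2mm]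 a_5=\dfrac{1+\cos\frac{2\pi}{7}}{\sin\frac{2\pi}{7}}, & w_5=\big(\cos\frac{\pi}{7},\ \sin\frac{\pi}{7}\big). \end{array}$$ Then for each $i=1,\dots,5$ the point $a_i$ lies in $A^L$, the vector $w_i$ is the left winner at $a_i$, and $a_i$ is the right endpoint of the winning interval of $w_i=(x,y)$: $W^L(w_i)=\big(\frac{x-1}{y},\,a_i\big]$. Moreover, $\{w_1,\dots,w_5\}$ is exactly the set of vectors that are left winners at some point of $A^L$, and exactly the set of vectors that are winning vectors at some point of $\Omega$. -/

import Mathlib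

noncomputable section

namespace DoubleHeptagon

/-! ### The double heptagon translation surface -/

/-- The vertices, in counterclockwise order, of the two regular heptagons with unit side length and
circumradius `1 / (2 sin (π / 7))`, each drawn in its own copy of the plane with its centre at `0`.
The heptagon `true` has a vertex at the top and a horizontal side at the bottom, and the heptagon
`false` is its image under the rotation by `π`. -/
def vertex (e : Bool) (k : Fin 7) : ℂ :=
  (if e then 1 else -1) * (1 / (2 * Real.sin (Real.pi / 7)) : ℝ) *
    (Complex.I * Complex.exp (2 * Real.pi * Complex.I * (k.val : ℂ) / 7))

/-- The closed heptagon. -/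
def heptagon (e : Bool) : Set ℂ := convexHull ℝ (Set.range (vertex e))

/-- The `k`-th side; the index `k + 1` is taken modulo `7`. -/
def side (e : Bool) (k : Fin 7) : Set ℂ := segment ℝ (vertex e k) (vertex e (k + 1))

/-- The disjoint union of the two closed heptagons. -/
def Polygons : Type := {p : Bool × ℂ // p.2 ∈ heptagon p.1}

/-- Each side is identified by a translation with the parallel side of the other heptagon: the
translation takes `vertex e k` to `vertex (!e) (k + 1) = -vertex e (k + 1)` and `vertex e (k + 1)`
to `vertex (!e) k = -vertex e k`. -/
def Glued (p q : Polygons) : Prop :=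
  ∃ k : Fin 7, p.1.2 ∈ side p.1.1 k ∧ q.1.1 = !p.1.1 ∧
    q.1.2 = p.1.2 - (vertex p.1.1 k + vertex p.1.1 (k + 1))

/-- The double heptagon: the quotient of the two heptagons by the equivalence relation that the
side identifications generate. -/
def Surface : Type := Quot Glued

/-- The image in the surface of a point `z` of the heptagon `e`. -/
def Surface.mk (e : Bool) (z : ℂ) (hz : z ∈ heptagon e) : Surface := Quot.mk Glued ⟨(e, z), hz⟩

/-- `x` is the cone point, that is, the image of a vertex (all vertices become one point). -/
def IsConePoint (x : Surface) : Prop :=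
  ∃ (e : Bool) (k : Fin 7) (h : vertex e k ∈ heptagon e), x = Surface.mk e (vertex e k) h

/-- `γ`, restricted to `[0, 1]`, is an oriented saddle connection with holonomy vector `v`: it runs
from the cone point to the cone point without meeting it in between, and it is a straight path with
constant velocity `v` in the flat coordinates: `[0, 1]` is cut at times `τ 0 ≤ ⋯ ≤ τ n` such that
between two consecutive times `γ` moves inside one of the closed heptagons with velocity `v`. -/
def IsSaddleConnection (γ : ℝ → Surface) (v : ℂ) : Prop :=
  IsConePoint (γ 0) ∧ IsConePoint (γ 1) ∧ (∀ t ∈ Set.Ioo (0 : ℝ) 1, ¬ IsConePoint (γ t)) ∧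
  ∃ (n : ℕ) (τ : ℕ → ℝ), τ 0 = 0 ∧ τ n = 1 ∧
    ∀ j < n, τ j ≤ τ (j + 1) ∧
      ∃ (e : Bool) (z : ℂ), ∀ t ∈ Set.Icc (τ j) (τ (j + 1)),
        ∃ h : z + ((t - τ j : ℝ) : ℂ) * v ∈ heptagon e,
          γ t = Surface.mk e (z + ((t - τ j : ℝ) : ℂ) * v) h

/-- The set `Λ` of holonomy vectors of the oriented saddle connections. -/
def holonomy : Set ℂ := {v | ∃ γ : ℝ → Surface, IsSaddleConnection γ v}

/-! ### The transversal and its winning vectors -/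

def x₀ : ℝ := Real.cos (Real.pi / 7)

def y₀ : ℝ := Real.sin (Real.pi / 7)

def α : ℝ := 2 * Real.cot (Real.pi / 7)

/-- The transversal `Ω`; its point `(a, b)` stands for the surface obtained by applying the matrix
`M_{b,-a}` with rows `(b, -a)` and `(0, 1 / b)` to the double heptagon. -/
def Omega : Set (ℝ × ℝ) :=
  {p | 0 < p.2 ∧ p.2 ≤ 1 ∧ x₀ / y₀ * p.2 - 1 / y₀ ≤ p.1 ∧ p.1 < (x₀ / y₀ + α) * p.2 - 1 / y₀}

/-- `M_{b,-a} v`, for the matrix with rows `(b, -a)` and `(0, 1 / b)`. -/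
def shear (a b : ℝ) (v : ℂ) : ℂ := ⟨b * v.re - a * v.im, v.im / b⟩

/-- The slope of a vector with nonzero `x`-component. -/
def slope (v : ℂ) : ℝ := v.im / v.re

/-- `v` is a candidate winning vector at `(a, b)`. -/
def IsCandidate (a b : ℝ) (v : ℂ) : Prop :=
  v ∈ holonomy ∧ 0 < (shear a b v).im ∧ 0 < (shear a b v).re ∧ (shear a b v).re ≤ 1

/-- `v` wins at `(a, b)`: among the holonomy vectors of the surface `M_{b,-a} (X, ω)` that have
positive slope and `x`-component in `(0, 1]`, the vector `M_{b,-a} v` has the least slope, and it is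
the shortest one of that slope. -/
def IsWinner (a b : ℝ) (v : ℂ) : Prop :=
  IsCandidate a b v ∧ ∀ u, IsCandidate a b u →
    slope (shear a b v) ≤ slope (shear a b u) ∧
      (slope (shear a b v) = slope (shear a b u) → ‖shear a b v‖ ≤ ‖shear a b u‖)

/-- `Ω^L`. -/
def OmegaL : Set (ℝ × ℝ) :=
  {p | 0 < p.2 ∧ p.2 ≤ 1 ∧ x₀ / y₀ * p.2 - 1 / y₀ < p.1 ∧ p.1 ≤ (x₀ / y₀ + α) * p.2 - 1 / y₀}

/-- The top edge `A^L` of `Ω^L`, as a set of real numbers. -/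
def edgeL : Set ℝ := {a | (a, 1) ∈ OmegaL}

/-- `v` is a candidate left winning vector at `(a, b)`. -/
def IsLeftCandidate (a b : ℝ) (v : ℂ) : Prop :=
  v ∈ holonomy ∧ 0 < v.im ∧ 0 ≤ b * v.re - a * v.im ∧ b * v.re - a * v.im < 1

/-- `v` is the left winner at `(a, b)`: the candidate left winning vector of least slope, and the
shortest one of that slope. An undefined slope counts as larger than every positive slope and
smaller than every negative slope, so for vectors in the open upper half-plane a smaller slope means
a larger quotient `x / y`. -/
def IsLeftWinner (a b : ℝ) (v : ℂ) : Prop :=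
  IsLeftCandidate a b v ∧ ∀ u, IsLeftCandidate a b u →
    u.re / u.im ≤ v.re / v.im ∧ (u.re / u.im = v.re / v.im → ‖v‖ ≤ ‖u‖)

/-- The left winning interval `W^L(v)`: the points of `A^L` at which `v` is the left winner. -/
def leftWinSet (v : ℂ) : Set ℝ := {a | a ∈ edgeL ∧ IsLeftWinner a 1 v}

/-! ### The table -/

open Real in
/-- The points `a₁, …, a₅`. -/
def point : Fin 5 → ℝ :=
  ![(3 * cos (π / 7) - 1) / sin (π / 7),
    (1 + 3 * cos (2 * π / 7)) / sin (2 * π / 7),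
    (4 * cos (π / 7) + 3 * cos (3 * π / 7) - 1) / sin (3 * π / 7),
    (4 * cos (π / 7) + cos (3 * π / 7) - 1) / sin (3 * π / 7),
    (1 + cos (2 * π / 7)) / sin (2 * π / 7)]

open Real in
/-- The vectors `w₁, …, w₅`. -/
def winner : Fin 5 → ℂ :=
  ![⟨2 + 3 * cos (2 * π / 7), sin (2 * π / 7)⟩,
    ⟨4 * cos (π / 7) + 3 * cos (3 * π / 7), sin (3 * π / 7)⟩,
    ⟨4 * cos (π / 7) + cos (3 * π / 7), sin (3 * π / 7)⟩,
    ⟨2 + cos (2 * π / 7), sin (2 * π / 7)⟩,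
    ⟨cos (π / 7), sin (π / 7)⟩]

end DoubleHeptagon

end

noncomputable section

namespace DoubleHeptagon

open Set

/-! Write `ζ` for the rotation by π/7, `σ` for the shear with rows (1, α) and (0, 1), and identify
the plane with ℂ. The winning vectors are the images under `σ` of ζ², …, ζ⁶, and the proof rests on
three facts about Λ.

(1) Symmetry. Λ is stable under `ζ` (`ζ_mul_mem_holonomy`), since this rotation exchanges the two
heptagons and respects the gluings. It is stable under `σ` (`σ_mem_holonomy`), since the surface is
a union of three horizontal cylinders whose circumference is α times their height
(`α_mul_level_sub`), so that one shear twists each of them exactly once. A relation between `ζ` and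
`σ` then gives stability under the inverse of `σ` (`σInv_eq`). As 1 ∈ Λ, all ζᵏ and σ(ζᵏ) lie in Λ.

(2) A gap. A saddle connection that is not horizontal must cross a cylinder, and the lowest cylinder
has height sin(π/7). So |Im v| is 0 or at least sin(π/7) for v ∈ Λ, and by rotation the same holds
for the area spanned by v and any ζᵏ (`sin_le_abs_cross`).

(3) Sectors. Since ζʲ and ζʲ⁺¹ span area sin(π/7), the gap says that a vector of Λ in the sector
between them has coordinates that are 0 or at least 1. If the x-component of M is nonnegative on
both, that of the vector is at least that of one of them (`exists_xComp_le`).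

Transported by `σ`, (3) shows that the winner is the first σ(ζᵏ), in order of slope, whose
x-component meets the upper bound 1 (`wins_σ_ζ_pow`). The conditions defining A^L and Ω say exactly
that k = 1 fails this bound and k = 6 meets it, so k runs through 2, …, 6. At b = 1 the threshold
for k is α − tan(kπ/14), which decreases in k (`endpt_eq`); consecutive thresholds bound the winning
intervals. -/

/-! ### The vertices -/

/-- The circumradius of the heptagons. -/
def circumradius : ℝ := 1 / (2 * Real.sin (Real.pi / 7))

/-- The height of the `n`-th vertex of the heptagon `true`. -/
def level (n : ℕ) : ℝ := circumradius * Real.cos (2 * Real.pi * n / 7)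

/-- The distance of the `n`-th vertex of the heptagon `true` from the vertical axis, for `n ≤ 3`. -/
def width (n : ℕ) : ℝ := circumradius * Real.sin (2 * Real.pi * n / 7)

lemma sin_pi_div_seven_pos : 0 < Real.sin (Real.pi / 7) :=
  Real.sin_pos_of_pos_of_lt_pi (by positivity) (by linarith [Real.pi_pos])

lemma cos_pi_div_seven_pos : 0 < Real.cos (Real.pi / 7) :=
  Real.cos_pos_of_mem_Ioo ⟨by linarith [Real.pi_pos], by linarith [Real.pi_pos]⟩

lemma circumradius_pos : 0 < circumradius := by
  have := sin_pi_div_seven_pos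
  unfold circumradius; positivity

lemma vertex_true (k : Fin 7) : vertex true k = ⟨-width k, level k⟩ := by
  have h : (2 * Real.pi * Complex.I * (k.val : ℂ) / 7) =
      ((2 * Real.pi * k / 7 : ℝ) : ℂ) * Complex.I := by push_cast; ring
  rw [vertex, h, Complex.exp_mul_I, ← Complex.ofReal_cos, ← Complex.ofReal_sin,
    show 1 / (2 * Real.sin (Real.pi / 7)) = circumradius from rfl]
  apply Complex.ext <;>
    simp [width, level, -Complex.ofReal_sin, -Complex.ofReal_cos]

lemma vertex_not (e : Bool) (k : Fin 7) : vertex (!e) k = -vertex e k := by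
  cases e <;> simp [vertex]

lemma vertex_false (k : Fin 7) : vertex false k = -vertex true k := vertex_not true k

lemma width_sub {n m : ℕ} (h : n + m = 7) : width n = -width m := by
  have : (2 * Real.pi * n / 7) = 2 * Real.pi - 2 * Real.pi * m / 7 := by
    have : (n : ℝ) = 7 - m := by
      have : ((n + m : ℕ) : ℝ) = 7 := by rw [h]; norm_num
      push_cast at this; linarith
    rw [this]; ring
  rw [width, this, Real.sin_two_pi_sub, width]; ring

lemma level_sub {n m : ℕ} (h : n + m = 7) : level n = level m := by
  have : (2 * Real.pi * n / 7) = 2 * Real.pi - 2 * Real.pi * m / 7 := by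
    have : (n : ℝ) = 7 - m := by
      have : ((n + m : ℕ) : ℝ) = 7 := by rw [h]; norm_num
      push_cast at this; linarith
    rw [this]; ring
  rw [level, this, Real.cos_two_pi_sub, level]

lemma width_zero : width 0 = 0 := by simp [width]

lemma width_four : width 4 = -width 3 := width_sub rfl
lemma width_five : width 5 = -width 2 := width_sub rfl
lemma width_six : width 6 = -width 1 := width_sub rfl
lemma level_four : level 4 = level 3 := level_sub rfl
lemma level_five : level 5 = level 2 := level_sub rfl
lemma level_six : level 6 = level 1 := level_sub rfl

lemma width_pos {n : ℕ} (h0 : 0 < n) (h : n ≤ 3) : 0 < width n := by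
  have h0' : (1 : ℝ) ≤ n := by exact_mod_cast h0
  have h' : (n : ℝ) ≤ 3 := by exact_mod_cast h
  refine mul_pos circumradius_pos (Real.sin_pos_of_pos_of_lt_pi ?_ ?_)
  · have := Real.pi_pos; positivity
  · nlinarith [Real.pi_pos]

lemma level_lt {n m : ℕ} (h : n < m) (hm : m ≤ 3) : level m < level n := by
  have h0 : (n : ℝ) < m := by exact_mod_cast h
  have h' : (m : ℝ) ≤ 3 := by exact_mod_cast hm
  have := Real.pi_pos
  refine mul_lt_mul_of_pos_left (Real.cos_lt_cos_of_nonneg_of_le_pi ?_ ?_ ?_) circumradius_pos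
  · positivity
  · nlinarith
  · nlinarith

lemma level_one_lt : level 1 < level 0 := level_lt (by norm_num) (by norm_num)
lemma level_two_lt : level 2 < level 1 := level_lt (by norm_num) (by norm_num)
lemma level_three_lt : level 3 < level 2 := level_lt (by norm_num) (by norm_num)

lemma norm_vertex (e : Bool) (k : Fin 7) : ‖vertex e k‖ = circumradius := by
  have h : ‖vertex true k‖ = circumradius := by
    rw [vertex_true, ← sq_eq_sq₀ (norm_nonneg _) circumradius_pos.le, Complex.sq_norm,
      Complex.normSq_mk, width, level]
    linear_combination circumradius ^ 2 * Real.sin_sq_add_cos_sq (2 * Real.pi * (k : ℕ) / 7)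
  cases e
  · rw [vertex_false, norm_neg, h]
  · exact h

/-! ### The heptagons -/

lemma vertex_mem (e : Bool) (k : Fin 7) : vertex e k ∈ heptagon e :=
  subset_convexHull ℝ _ (mem_range_self k)

lemma neg_mem_heptagon {e : Bool} {z : ℂ} : -z ∈ heptagon (!e) ↔ z ∈ heptagon e := by
  have h : heptagon (!e) = -heptagon e := by
    unfold heptagon
    rw [← convexHull_neg]
    congr 1
    ext w
    simp only [mem_range, Set.mem_neg, vertex_not]
    exact exists_congr fun k => neg_eq_iff_eq_neg
  rw [h, Set.neg_mem_neg]

lemma heptagon_subset_of_convex {e : Bool} {s : Set ℂ} (hs : Convex ℝ s)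
    (h : ∀ k, vertex e k ∈ s) : heptagon e ⊆ s :=
  convexHull_min (range_subset_iff.2 h) hs

lemma convex_heptagon (e : Bool) : Convex ℝ (heptagon e) := convex_convexHull ℝ _

lemma heptagon_subset_closedBall (e : Bool) :
    heptagon e ⊆ Metric.closedBall 0 circumradius :=
  heptagon_subset_of_convex (convex_closedBall _ _) fun k => by simp [norm_vertex]

lemma side_subset (e : Bool) (k : Fin 7) : side e k ⊆ heptagon e :=
  (convex_heptagon e).segment_subset (vertex_mem e k) (vertex_mem e (k + 1))

/-- The circumscribed disc is strictly convex, so a point of the heptagon on its boundary circle is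
extreme in the disc, hence in the heptagon, hence a vertex. -/
lemma mem_range_vertex_of_norm {e : Bool} {z : ℂ} (hz : z ∈ heptagon e)
    (h : ‖z‖ = circumradius) : z ∈ range (vertex e) := by
  apply extremePoints_convexHull_subset (𝕜 := ℝ)
  refine inter_extremePoints_subset_extremePoints_of_subset (heptagon_subset_closedBall e) ⟨hz, ?_⟩
  rw [StrictConvexSpace.extremePoints_closedBall_eq_sphere]
  simpa using h

lemma im_mem_of_mem_heptagon {z : ℂ} (hz : z ∈ heptagon true) :
    level 3 ≤ z.im ∧ z.im ≤ level 0 := by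
  have h1 := level_one_lt
  have h2 := level_two_lt
  have h3 := level_three_lt
  have h := heptagon_subset_of_convex (e := true)
    (s := {z : ℂ | level 3 ≤ z.im} ∩ {z : ℂ | z.im ≤ level 0})
    ((convex_halfSpace_im_ge _).inter (convex_halfSpace_im_le _)) (fun k => by
      rw [vertex_true]
      fin_cases k <;>
        simp only [mem_inter_iff, mem_ofPred_eq, level_four, level_five, level_six] <;>
        constructor <;> linarith)
  exact h hz

/-! ### Points of the surface -/

/-- The image of `z` in the surface, with a fixed value where `z` is outside the heptagon `e`. -/
def pt (e : Bool) (z : ℂ) : Surface :=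
  open Classical in
  if h : z ∈ heptagon e then Surface.mk e z h else Surface.mk e (vertex e 0) (vertex_mem e 0)

lemma pt_eq {e : Bool} {z : ℂ} (h : z ∈ heptagon e) : pt e z = Surface.mk e z h := dif_pos h

lemma exists_pt (x : Surface) : ∃ e z, z ∈ heptagon e ∧ x = pt e z := by
  induction x using Quot.ind with
  | mk p => exact ⟨p.1.1, p.1.2, p.2, (pt_eq p.2).symm⟩

/-- The translation that glues the side `k` of `e` to a side of `!e` sends a point `z` to
`z - gluing e k`. -/
def gluing (e : Bool) (k : Fin 7) : ℂ := vertex e k + vertex e (k + 1)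

lemma gluing_not (e : Bool) (k : Fin 7) : gluing (!e) k = -gluing e k := by
  simp only [gluing, vertex_not]; ring

lemma sub_gluing_mem_side {e : Bool} {k : Fin 7} {z : ℂ} (h : z ∈ side e k) :
    z - gluing e k ∈ side (!e) k := by
  obtain ⟨a, b, ha, hb, hab, rfl⟩ := h
  refine ⟨b, a, hb, ha, by linarith, ?_⟩
  obtain rfl : b = 1 - a := by linarith
  simp only [gluing, vertex_not]
  module

lemma pt_glue {e : Bool} {k : Fin 7} {z : ℂ} (h : z ∈ side e k) :
    pt e z = pt (!e) (z - gluing e k) := by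
  rw [pt_eq (side_subset _ _ h), pt_eq (side_subset _ _ (sub_gluing_mem_side h))]
  exact Quot.sound ⟨k, h, rfl, rfl⟩

/-- A function on the pairs of a heptagon and a point of it which agrees on glued points. -/
lemma exists_lift {β : Type*} (f : Bool → ℂ → β)
    (h : ∀ k, ∀ z ∈ side true k, f true z = f false (z - gluing true k)) :
    ∃ g : Surface → β, ∀ e, ∀ z ∈ heptagon e, g (pt e z) = f e z := by
  refine ⟨Quot.lift (fun p : Polygons => f p.1.1 p.1.2) ?_, fun e z hz => by
    rw [pt_eq hz]; rfl⟩
  rintro ⟨⟨e, z⟩, hz⟩ ⟨⟨e', z'⟩, hz'⟩ ⟨k, hk, h1, h2⟩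
  simp only at hk h1 h2 ⊢
  subst h1 h2
  cases e
  · have := h k (z - gluing false k) (sub_gluing_mem_side (e := false) hk)
    have e1 : gluing true k = -gluing false k := gluing_not false k
    rw [e1] at this
    simp only [sub_neg_eq_add, sub_add_cancel] at this
    exact this.symm
  · exact h k z hk

/-- On a side, the gluing is the reflection in the midpoint of the side followed by z ↦ −z. Both
keep the distance to the centre, because the ends of the side are equally far from it. -/
lemma norm_sub_gluing {e : Bool} {k : Fin 7} {z : ℂ} (h : z ∈ side e k) :
    ‖z - gluing e k‖ = ‖z‖ := by
  obtain ⟨a, b, ha, hb, hab, rfl⟩ := h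
  obtain rfl : b = 1 - a := by linarith
  have h1 := norm_vertex e k
  rw [← norm_vertex e (k + 1), ← sq_eq_sq₀ (norm_nonneg _) (norm_nonneg _), Complex.sq_norm,
    Complex.sq_norm, Complex.normSq_apply, Complex.normSq_apply] at h1
  rw [← sq_eq_sq₀ (norm_nonneg _) (norm_nonneg _), Complex.sq_norm, Complex.sq_norm,
    Complex.normSq_apply, Complex.normSq_apply]
  simp [gluing]
  linear_combination (1 - 2 * a) * h1

/-- The distance to the centre of the heptagon is invariant under the gluings, so it is a function
on the surface, and it attains the circumradius only at vertices. -/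
lemma isConePoint_pt {e : Bool} {z : ℂ} (hz : z ∈ heptagon e) :
    IsConePoint (pt e z) ↔ ‖z‖ = circumradius := by
  constructor
  · rintro ⟨e', k, h, hx⟩
    obtain ⟨N, hN⟩ := exists_lift (fun _ z => ‖z‖) fun k z hz => (norm_sub_gluing hz).symm
    rw [← hN e z hz, hx, ← pt_eq h, hN _ _ h, norm_vertex]
  · intro h
    obtain ⟨k, rfl⟩ := mem_range_vertex_of_norm hz h
    exact ⟨e, k, hz, pt_eq hz⟩

/-! ### Straight paths -/

/-- On `[a, b]` the path `γ` is straight with velocity `v`. -/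
inductive Straight (γ : ℝ → Surface) (v : ℂ) : ℝ → ℝ → Prop
  | piece {a b : ℝ} (e : Bool) (z : ℂ) (hab : a ≤ b)
      (h : ∀ t ∈ Icc a b, z + ((t - a : ℝ) : ℂ) * v ∈ heptagon e ∧
        γ t = pt e (z + ((t - a : ℝ) : ℂ) * v)) : Straight γ v a b
  | trans {a b c : ℝ} (h₁ : Straight γ v a b) (h₂ : Straight γ v b c) : Straight γ v a c

lemma Straight.exists_subdivision {γ : ℝ → Surface} {v : ℂ} {a b : ℝ} (h : Straight γ v a b) :
    ∃ (n : ℕ) (τ : ℕ → ℝ), τ 0 = a ∧ τ n = b ∧ ∀ j < n, τ j ≤ τ (j + 1) ∧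
      ∃ (e : Bool) (z : ℂ), ∀ t ∈ Icc (τ j) (τ (j + 1)),
        ∃ h : z + ((t - τ j : ℝ) : ℂ) * v ∈ heptagon e,
          γ t = Surface.mk e (z + ((t - τ j : ℝ) : ℂ) * v) h := by
  induction h with
  | @piece a b e z hab h =>
    refine ⟨1, fun j => if j = 0 then a else b, by simp, by simp, fun j hj => ?_⟩
    obtain rfl : j = 0 := by omega
    simp only [if_true, zero_add, one_ne_zero, if_false]
    refine ⟨hab, e, z, fun t ht => ⟨(h t ht).1, ?_⟩⟩
    exact (h t ht).2.trans (pt_eq _)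
  | trans h₁ h₂ ih₁ ih₂ =>
    obtain ⟨n, τ, h0, hn, h⟩ := ih₁
    obtain ⟨m, σ, k0, km, k⟩ := ih₂
    refine ⟨n + m, fun j => if j ≤ n then τ j else σ (j - n), by simp [h0], ?_, fun j hj => ?_⟩
    · rcases Nat.eq_zero_or_pos m with rfl | hm
      · simp [hn, ← km, k0]
      · simp [km, hm.ne']
    · rcases lt_or_ge j n with hjn | hjn
      · have h1 : j + 1 ≤ n := hjn
        simp only [hjn.le, h1, if_true]
        exact h j hjn
      · have h1 : ¬ j + 1 ≤ n := by omega
        have h2 : (if j ≤ n then τ j else σ (j - n)) = σ (j - n) := by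
          split_ifs with h3
          · obtain rfl : j = n := by omega
            simp [hn, k0]
          · rfl
        have h3 : j + 1 - n = (j - n) + 1 := by omega
        simp only [h1, if_false, h2, h3]
        exact k (j - n) (by omega)

lemma straight_of_subdivision {γ : ℝ → Surface} {v : ℂ} (n : ℕ) (τ : ℕ → ℝ)
    (h : ∀ j < n, τ j ≤ τ (j + 1) ∧
      ∃ (e : Bool) (z : ℂ), ∀ t ∈ Icc (τ j) (τ (j + 1)),
        ∃ h : z + ((t - τ j : ℝ) : ℂ) * v ∈ heptagon e,
          γ t = Surface.mk e (z + ((t - τ j : ℝ) : ℂ) * v) h) :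
    n ≠ 0 → Straight γ v (τ 0) (τ n) := by
  intro hn
  induction n, Nat.one_le_iff_ne_zero.2 hn using Nat.le_induction with
  | base =>
    obtain ⟨h1, e, z, h2⟩ := h 0 (by omega)
    exact .piece e z h1 fun t ht => by
      obtain ⟨h3, h4⟩ := h2 t ht
      exact ⟨h3, by rw [h4, pt_eq h3]⟩
  | succ n hn' ih =>
    refine (ih (fun j hj => h j (by omega)) (by omega)).trans ?_
    obtain ⟨h1, e, z, h2⟩ := h n (by omega)
    exact .piece e z h1 fun t ht => by
      obtain ⟨h3, h4⟩ := h2 t ht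
      exact ⟨h3, by rw [h4, pt_eq h3]⟩

lemma isSaddleConnection_iff {γ : ℝ → Surface} {v : ℂ} :
    IsSaddleConnection γ v ↔ IsConePoint (γ 0) ∧ IsConePoint (γ 1) ∧
      (∀ t ∈ Ioo (0 : ℝ) 1, ¬ IsConePoint (γ t)) ∧ Straight γ v 0 1 := by
  refine and_congr_right fun _ => and_congr_right fun _ => and_congr_right fun _ => ⟨?_, ?_⟩
  · rintro ⟨n, τ, h0, h1, h⟩
    have hn : n ≠ 0 := by
      rintro rfl
      rw [h0] at h1; norm_num at h1
    rw [← h0, ← h1]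
    exact straight_of_subdivision n τ h hn
  · exact Straight.exists_subdivision

lemma Straight.le {γ : ℝ → Surface} {v : ℂ} {a b : ℝ} (h : Straight γ v a b) : a ≤ b := by
  induction h with
  | piece _ _ hab _ => exact hab
  | trans _ _ ih₁ ih₂ => exact ih₁.trans ih₂

/-- A property of intervals that is additive holds on an interval as soon as it holds on the
subintervals on which a given affine function has constant sign. -/
lemma of_sign_cut {P : ℝ → ℝ → Prop} (htrans : ∀ {a b c}, P a b → P b c → P a c) {a b : ℝ}
    (hab : a ≤ b) (p q : ℝ)
    (hneg : ∀ a' b', a ≤ a' → a' ≤ b' → b' ≤ b → (∀ t ∈ Icc a' b', p + q * t ≤ 0) → P a' b')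
    (hpos : ∀ a' b', a ≤ a' → a' ≤ b' → b' ≤ b → (∀ t ∈ Icc a' b', 0 ≤ p + q * t) → P a' b') :
    P a b := by
  rcases le_total (p + q * a) 0 with ha | ha <;> rcases le_total (p + q * b) 0 with hb | hb
  · refine hneg a b le_rfl hab le_rfl fun t ht => ?_
    rcases le_total q 0 with h | h <;> nlinarith [ht.1, ht.2]
  -- If `q ≤ 0`, the function vanishes at both ends and no cut is needed; otherwise the cut is at
  -- its root `-p / q`.
  · rcases le_or_gt q 0 with hq | hq'
    · exact hpos a b le_rfl hab le_rfl fun t ht => by nlinarith [ht.2]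
    have e : p + q * (-p / q) = 0 := by field_simp; ring
    have h1 : a ≤ -p / q := by rw [le_div_iff₀ hq']; linarith
    have h2 : -p / q ≤ b := by rw [div_le_iff₀ hq']; linarith
    exact htrans (hneg a _ le_rfl h1 h2 fun t ht => by nlinarith [ht.2])
      (hpos _ b h1 h2 le_rfl fun t ht => by nlinarith [ht.1])
  · rcases le_or_gt 0 q with hq | hq'
    · exact hneg a b le_rfl hab le_rfl fun t ht => by nlinarith [ht.2]
    have e : p + q * (-p / q) = 0 := by 
      have := hq'.ne
      field_simp; ring
    have h1 : a ≤ -p / q := by rw [le_div_iff_of_neg hq']; linarith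
    have h2 : -p / q ≤ b := by rw [div_le_iff_of_neg hq']; linarith
    exact htrans (hpos a _ le_rfl h1 h2 fun t ht => by nlinarith [ht.2])
      (hneg _ b h1 h2 le_rfl fun t ht => by nlinarith [ht.1])
  · refine hpos a b le_rfl hab le_rfl fun t ht => ?_
    rcases le_total q 0 with h | h <;> nlinarith [ht.1, ht.2]

/-! ### Transport of saddle connections -/

lemma Straight.congr {γ γ' : ℝ → Surface} {v : ℂ} {a b : ℝ} (h : Straight γ v a b)
    (hγ : ∀ t ∈ Icc a b, γ' t = γ t) : Straight γ' v a b := by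
  induction h with
  | piece e z hab h => exact .piece e z hab fun t ht => ⟨(h t ht).1, (hγ t ht).trans (h t ht).2⟩
  | trans h₁ h₂ ih₁ ih₂ =>
    exact .trans (ih₁ fun t ht => hγ t ⟨ht.1, ht.2.trans h₂.le⟩)
      (ih₂ fun t ht => hγ t ⟨h₁.le.trans ht.1, ht.2⟩)

/-- This serves for the rotation and for the Dehn twist. A straight piece in one heptagon may go to
a concatenation of pieces, because the twist spreads it over several polygons. -/
lemma holonomy_transport {φ : Surface → Surface} {v v' : ℂ}
    (hcone : ∀ x, IsConePoint (φ x) ↔ IsConePoint x)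
    (hpiece : ∀ (e : Bool) (z : ℂ) (a b : ℝ), a ≤ b →
      (∀ t ∈ Icc a b, z + ((t - a : ℝ) : ℂ) * v ∈ heptagon e) →
      Straight (fun t => φ (pt e (z + ((t - a : ℝ) : ℂ) * v))) v' a b)
    (hv : v ∈ holonomy) : v' ∈ holonomy := by
  obtain ⟨γ, hγ⟩ := hv
  obtain ⟨h0, h1, hne, hs⟩ := isSaddleConnection_iff.1 hγ
  refine ⟨fun t => φ (γ t), isSaddleConnection_iff.2
    ⟨(hcone _).2 h0, (hcone _).2 h1, fun t ht h => hne t ht ((hcone _).1 h), ?_⟩⟩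
  clear h0 h1 hne hγ
  -- The induction on `Straight` needs arbitrary end times.
  generalize (0 : ℝ) = a, (1 : ℝ) = b at hs ⊢
  induction hs with
  | piece e z hab h =>
    refine (hpiece e z _ _ hab fun t ht => (h t ht).1).congr fun t ht => ?_
    rw [(h t ht).2]
  | trans _ _ ih₁ ih₂ => exact ih₁.trans ih₂

/-! ### The rotation by `π / 7` -/

/-- The rotation by `π / 7`. -/
def ζ : ℂ := Complex.exp (((Real.pi / 7 : ℝ) : ℂ) * Complex.I)

lemma ζ_pow (n : ℕ) : ζ ^ n = ⟨Real.cos (n * Real.pi / 7), Real.sin (n * Real.pi / 7)⟩ := by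
  have h : (n : ℂ) * (((Real.pi / 7 : ℝ) : ℂ) * Complex.I) =
      ((n * Real.pi / 7 : ℝ) : ℂ) * Complex.I := by push_cast; ring
  rw [ζ, ← Complex.exp_nat_mul, h, Complex.exp_mul_I, ← Complex.ofReal_cos, ← Complex.ofReal_sin]
  apply Complex.ext <;> simp [-Complex.ofReal_sin, -Complex.ofReal_cos]

lemma ζ_pow_seven : ζ ^ 7 = -1 := by
  rw [ζ_pow]
  have h : ((7 : ℕ) * Real.pi / 7 : ℝ) = Real.pi := by push_cast; ring
  rw [h]
  apply Complex.ext <;> simp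

lemma norm_ζ : ‖ζ‖ = 1 := Complex.norm_exp_ofReal_mul_I _

/-- π/7 = 4 · 2π/7 − π: the rotation is four steps along the vertices followed by a half turn, which
exchanges the heptagons. -/
lemma vertex_add_four (e : Bool) (k : Fin 7) : vertex (!e) (k + 4) = ζ * vertex e k := by
  have h : Complex.exp (2 * Real.pi * Complex.I * ((k + 4 : Fin 7).val : ℂ) / 7) =
      -(ζ * Complex.exp (2 * Real.pi * Complex.I * (k.val : ℂ) / 7)) := by
    have h1 : ((k : ℕ) + 4 : ℂ) = ((k + 4 : Fin 7).val : ℂ) + 7 * (((k : ℕ) + 4) / 7 : ℕ) := by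
      rw [Fin.val_add]
      exact_mod_cast (Nat.mod_add_div ((k : ℕ) + 4) 7).symm
    have h2 : 2 * Real.pi * Complex.I * ((k + 4 : Fin 7).val : ℂ) / 7 =
        ((Real.pi / 7 : ℝ) : ℂ) * Complex.I + 2 * Real.pi * Complex.I * (k.val : ℂ) / 7 +
          Real.pi * Complex.I - (((k : ℕ) + 4) / 7 : ℕ) * (2 * Real.pi * Complex.I) := by
      rw [← sub_eq_iff_eq_add.2 h1]
      push_cast; ring
    rw [h2, Complex.exp_periodic.sub_nat_mul_eq, Complex.exp_add, Complex.exp_add,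
      Complex.exp_pi_mul_I, ζ]
    ring
  cases e <;> simp only [vertex, h, Bool.not_false, Bool.not_true, if_true, if_false,
    Bool.false_eq_true] <;> ring

lemma ζ_mul_gluing (e : Bool) (k : Fin 7) : gluing (!e) (k + 4) = ζ * gluing e k := by
  rw [gluing, gluing, add_right_comm, vertex_add_four, vertex_add_four]; ring

lemma ζ_mul_mem {e : Bool} {z : ℂ} (h : z ∈ heptagon e) : ζ * z ∈ heptagon (!e) := by
  have hc : Convex ℝ ((LinearMap.mulLeft ℝ ζ : ℂ → ℂ) ⁻¹' heptagon (!e)) :=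
    (convex_heptagon (!e)).linear_preimage (LinearMap.mulLeft ℝ ζ)
  exact heptagon_subset_of_convex hc
    (fun k => by
      change ζ * vertex e k ∈ heptagon (!e)
      rw [← vertex_add_four]
      exact vertex_mem _ _) h

lemma ζ_mul_mem_side {e : Bool} {k : Fin 7} {z : ℂ} (h : z ∈ side e k) :
    ζ * z ∈ side (!e) (k + 4) := by
  obtain ⟨a, b, ha, hb, hab, rfl⟩ := h
  refine ⟨a, b, ha, hb, hab, ?_⟩
  rw [add_right_comm, vertex_add_four, vertex_add_four]
  simp only [Complex.real_smul]
  ring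

lemma ζ_mul_mem_holonomy {v : ℂ} (hv : v ∈ holonomy) : ζ * v ∈ holonomy := by
  have hglue : ∀ k : Fin 7, ∀ z ∈ side true k,
      pt (!true) (ζ * z) = pt (!false) (ζ * (z - gluing true k)) := fun k z hz => by
    rw [mul_sub, ← ζ_mul_gluing]
    exact pt_glue (ζ_mul_mem_side hz)
  obtain ⟨φ, hφ⟩ := exists_lift (fun e z => pt (!e) (ζ * z)) hglue
  refine holonomy_transport (φ := φ) (fun x => ?_) (fun e z a b hab h => ?_) hv
  · obtain ⟨e, z, hz, rfl⟩ := exists_pt x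
    rw [hφ e z hz, isConePoint_pt hz, isConePoint_pt (ζ_mul_mem hz), norm_mul, norm_ζ, one_mul]
  · refine .piece (!e) (ζ * z) hab fun t ht => ?_
    have e1 : ζ * z + ((t - a : ℝ) : ℂ) * (ζ * v) = ζ * (z + ((t - a : ℝ) : ℂ) * v) := by ring
    rw [e1]
    exact ⟨ζ_mul_mem (h t ht), hφ _ _ (h t ht)⟩

lemma ζ_pow_mul_mem_holonomy {v : ℂ} (hv : v ∈ holonomy) (n : ℕ) : ζ ^ n * v ∈ holonomy := by
  induction n with
  | zero => simpa using hv
  | succ n ih =>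
    rw [pow_succ', mul_assoc]
    exact ζ_mul_mem_holonomy ih

lemma neg_mem_holonomy {v : ℂ} (hv : v ∈ holonomy) : -v ∈ holonomy := by
  simpa [ζ_pow_seven] using ζ_pow_mul_mem_holonomy hv 7

/-! ### A saddle connection -/

lemma two_mul_width_three : 2 * width 3 = 1 := by
  have h : (2 * Real.pi * (3 : ℕ) / 7 : ℝ) = Real.pi - Real.pi / 7 := by push_cast; ring
  rw [width, h, Real.sin_pi_sub, circumradius]
  have := sin_pi_div_seven_pos.ne'
  field_simp

/-- The saddle connection is the horizontal bottom side of the heptagon `true`; its interior points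
are closer to the centre than its ends. -/
lemma one_mem_holonomy : (1 : ℂ) ∈ holonomy := by
  have e3 : vertex true 3 = ⟨-(1 / 2), level 3⟩ := by
    rw [vertex_true]
    apply Complex.ext
    · have := two_mul_width_three
      change -width 3 = _
      linarith
    · rfl
  have e4 : vertex true 4 = vertex true 3 + 1 := by
    rw [e3, vertex_true]
    apply Complex.ext
    · have := two_mul_width_three
      have h := width_four
      change -width 4 = -(1 / 2) + 1
      linarith
    · change level 4 = level 3 + 0
      rw [level_four, add_zero]
  have hmem : ∀ t ∈ Icc (0 : ℝ) 1, vertex true 3 + (t : ℂ) ∈ heptagon true := fun t ht => by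
    refine side_subset true 3 ⟨1 - t, t, by linarith [ht.2], ht.1, by ring, ?_⟩
    change _ • vertex true 3 + _ • vertex true 4 = _
    rw [e4]
    simp only [Complex.real_smul]
    push_cast; ring
  have hn : ‖vertex true 3‖ ^ 2 = circumradius ^ 2 := by rw [norm_vertex]
  refine ⟨fun t => pt true (vertex true 3 + (t : ℂ)), isSaddleConnection_iff.2 ⟨?_, ?_, ?_, ?_⟩⟩
  · rw [isConePoint_pt (hmem 0 (by simp))]
    simp [norm_vertex]
  · rw [isConePoint_pt (hmem 1 (by simp))]
    rw [Complex.ofReal_one, ← e4, norm_vertex]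
  · intro t ht h
    rw [isConePoint_pt (hmem t ⟨ht.1.le, ht.2.le⟩)] at h
    have h2 : ‖vertex true 3 + (t : ℂ)‖ ^ 2 = circumradius ^ 2 := by rw [h]
    rw [← hn, e3, Complex.sq_norm, Complex.sq_norm, Complex.normSq_apply,
      Complex.normSq_apply] at h2
    simp at h2
    nlinarith [ht.1, ht.2]
  · refine .piece true (vertex true 3) zero_le_one fun t ht => ?_
    simp only [sub_zero, mul_one, and_true]
    exact hmem t ht

/-! ### The heights of the horizontal cylinders -/

lemma level_sub_level (n : ℕ) :
    level n - level (n + 1) = Real.sin ((2 * n + 1) * Real.pi / 7) := by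
  have h1 : (2 * Real.pi * n / 7 : ℝ) = (2 * n + 1) * Real.pi / 7 - Real.pi / 7 := by ring
  have h2 : (2 * Real.pi * (n + 1 : ℕ) / 7 : ℝ) = (2 * n + 1) * Real.pi / 7 + Real.pi / 7 := by
    push_cast; ring
  rw [level, level, h1, h2, Real.cos_sub, Real.cos_add, circumradius]
  have := sin_pi_div_seven_pos.ne'
  field_simp
  ring

lemma sin_le_level_sub_level {n : ℕ} (hn : n ≤ 2) :
    Real.sin (Real.pi / 7) ≤ level n - level (n + 1) := by
  have hpi := Real.pi_pos
  rw [level_sub_level]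
  interval_cases n
  · apply le_of_eq; congr 1; push_cast; ring
  · apply Real.sin_le_sin_of_le_of_le_pi_div_two <;> push_cast <;> linarith
  · rw [← Real.sin_pi_sub ((2 * (2 : ℕ) + 1) * Real.pi / 7)]
    apply Real.sin_le_sin_of_le_of_le_pi_div_two <;> push_cast <;> linarith

/-- The height of a point of the heptagon `e` above the highest horizontal line below it that
contains a vertex. -/
def height (e : Bool) (z : ℂ) : ℝ :=
  if e then
    if z.im < level 2 then z.im - level 3 else if z.im < level 1 then z.im - level 2
    else if z.im < level 0 then z.im - level 1 else z.im - level 0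
  else
    if z.im < -level 1 then z.im + level 0 else if z.im < -level 2 then z.im + level 1
    else if z.im < -level 3 then z.im + level 2 else z.im + level 3

lemma exists_of_mem_side {k : Fin 7} {z : ℂ} (h : z ∈ side true k) :
    ∃ a b : ℝ, 0 ≤ a ∧ 0 ≤ b ∧ a + b = 1 ∧
      z.re = -(a * width k + b * width (k + 1 : Fin 7)) ∧
      z.im = a * level k + b * level (k + 1 : Fin 7) := by
  obtain ⟨a, b, ha, hb, hab, rfl⟩ := h
  refine ⟨a, b, ha, hb, hab, ?_, ?_⟩ <;> simp [vertex_true]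
  ring

lemma im_gluing (k : Fin 7) : (gluing true k).im = level k + level (k + 1 : Fin 7) := by
  simp [gluing, vertex_true]

/-- A point of a side lies between two consecutive levels. -/
lemma levels_of_mem_side {k : Fin 7} {z : ℂ} (h : z ∈ side true k) :
    ∃ n m : ℕ, (gluing true k).im = level n + level m ∧ level m ≤ z.im ∧ z.im ≤ level n ∧
      m ≤ 3 ∧ (m = n + 1 ∨ m = 3 ∧ n = 3) := by
  obtain ⟨a, b, ha, hb, hab, -, h⟩ := exists_of_mem_side h
  have key : ∀ n m : ℕ, level m ≤ level n → (level k = level n ∧ level (k + 1 : Fin 7) = level m ∨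
      level k = level m ∧ level (k + 1 : Fin 7) = level n) →
      (gluing true k).im = level n + level m ∧ level m ≤ z.im ∧ z.im ≤ level n := by
    intro n m hl hk
    obtain rfl : b = 1 - a := by linarith
    rw [im_gluing, h]
    rcases hk with ⟨h1, h2⟩ | ⟨h1, h2⟩ <;> rw [h1, h2] <;>
      exact ⟨by ring, by nlinarith, by nlinarith⟩
  have h01 := key 0 1 level_one_lt.le
  have h12 := key 1 2 level_two_lt.le
  have h23 := key 2 3 level_three_lt.le
  have h33 := key 3 3 le_rfl
  have e4 := level_four
  have e5 := level_five
  have e6 := level_six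
  clear key h
  fin_cases k
  · obtain ⟨x, y, w⟩ := h01 (.inl ⟨rfl, rfl⟩)
    exact ⟨0, 1, x, y, w, by norm_num⟩
  · obtain ⟨x, y, w⟩ := h12 (.inl ⟨rfl, rfl⟩)
    exact ⟨1, 2, x, y, w, by norm_num⟩
  · obtain ⟨x, y, w⟩ := h23 (.inl ⟨rfl, rfl⟩)
    exact ⟨2, 3, x, y, w, by norm_num⟩
  · obtain ⟨x, y, w⟩ := h33 (.inl ⟨rfl, e4⟩)
    exact ⟨3, 3, x, y, w, by norm_num⟩
  · obtain ⟨x, y, w⟩ := h23 (.inr ⟨e4, e5⟩)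
    exact ⟨2, 3, x, y, w, by norm_num⟩
  · obtain ⟨x, y, w⟩ := h12 (.inr ⟨e5, e6⟩)
    exact ⟨1, 2, x, y, w, by norm_num⟩
  · obtain ⟨x, y, w⟩ := h01 (.inr ⟨e6, rfl⟩)
    exact ⟨0, 1, x, y, w, by norm_num⟩

/-- A slanted side spans one strip, and its gluing carries the bottom line of that strip to the
bottom line of a strip of the other heptagon. On the horizontal side both heights are 0. -/
lemma height_glue (k : Fin 7) (z : ℂ) (hz : z ∈ side true k) :
    height true z = height false (z - gluing true k) := by
  obtain ⟨n, m, h, hm, hn, hm3, hnm⟩ := levels_of_mem_side hz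
  have h1 := level_one_lt
  have h2 := level_two_lt
  have h3 := level_three_lt
  simp only [height, Complex.sub_im, h, if_true, if_false, Bool.false_eq_true]
  rcases hnm with rfl | ⟨rfl, rfl⟩
  · obtain rfl | rfl | rfl : n = 0 ∨ n = 1 ∨ n = 2 := by omega
    all_goals norm_num only at hm hn ⊢
    all_goals split_ifs <;> linarith
  · split_ifs <;> linarith

lemma height_vertex (e : Bool) (k : Fin 7) : height e (vertex e k) = 0 := by
  have h1 := level_one_lt
  have h2 := level_two_lt
  have h3 := level_three_lt
  have e4 := level_four
  have e5 := level_five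
  have e6 := level_six
  have key : ∀ n : ℕ, n ≤ 3 → level k = level n → height e (vertex e k) = 0 := by
    intro n hn h
    cases e <;> simp only [height, vertex_false, vertex_true, Complex.neg_im, h, if_true,
      if_false, Bool.false_eq_true] <;>
    · obtain rfl | rfl | rfl | rfl : n = 0 ∨ n = 1 ∨ n = 2 ∨ n = 3 := by omega
      all_goals split_ifs <;> linarith
  fin_cases k
  · exact key 0 (by norm_num) rfl
  · exact key 1 (by norm_num) rfl
  · exact key 2 (by norm_num) rfl
  · exact key 3 (by norm_num) rfl
  · exact key 3 (by norm_num) e4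
  · exact key 2 (by norm_num) e5
  · exact key 1 (by norm_num) e6

lemma im_mem_of_mem_heptagon_false {z : ℂ} (hz : z ∈ heptagon false) :
    -level 0 ≤ z.im ∧ z.im ≤ -level 3 := by
  have := im_mem_of_mem_heptagon (z := -z) (neg_mem_heptagon (e := false) |>.2 hz)
  rw [Complex.neg_im] at this
  constructor <;> linarith

/-- Every strip is at least sin(π/7) high, so a rise that keeps the height below this value cannot
reach the next line of vertices. -/
lemma height_add {e : Bool} {z w : ℂ} (hz : z ∈ heptagon e) (hw : w ∈ heptagon e)
    (h : z.im ≤ w.im) (hlt : height e z + (w.im - z.im) < Real.sin (Real.pi / 7)) :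
    height e w = height e z + (w.im - z.im) := by
  have h0 := sin_pi_div_seven_pos
  have h1 := sin_le_level_sub_level (n := 0) (by norm_num)
  have h2 := sin_le_level_sub_level (n := 1) (by norm_num)
  have h3 := sin_le_level_sub_level (n := 2) (by norm_num)
  norm_num only at h1 h2 h3
  cases e
  · have a1 := im_mem_of_mem_heptagon_false hz
    have a2 := im_mem_of_mem_heptagon_false hw
    simp only [height, if_false, Bool.false_eq_true] at hlt ⊢
    generalize level 0 = l₀, level 1 = l₁, level 2 = l₂, level 3 = l₃ at *
    generalize Real.sin (Real.pi / 7) = s at *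
    split_ifs at hlt ⊢ <;> linarith
  · have a1 := im_mem_of_mem_heptagon hz
    have a2 := im_mem_of_mem_heptagon hw
    simp only [height, if_true] at hlt ⊢
    generalize level 0 = l₀, level 1 = l₁, level 2 = l₂, level 3 = l₃ at *
    generalize Real.sin (Real.pi / 7) = s at *
    split_ifs at hlt ⊢ <;> linarith

/-- Along a saddle connection that rises by less than sin(π/7), the height starts at 0 and equals
the total rise throughout. At the end it would be `v.im > 0`, whereas the cone point has height 0.
-/
lemma sin_le_im_of_mem_holonomy {v : ℂ} (hv : v ∈ holonomy) (h : 0 < v.im) :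
    Real.sin (Real.pi / 7) ≤ v.im := by
  by_contra! hlt
  obtain ⟨γ, hγ⟩ := hv
  obtain ⟨h0, h1, -, hs⟩ := isSaddleConnection_iff.1 hγ
  obtain ⟨g, hg⟩ := exists_lift height height_glue
  have hcone : ∀ x, IsConePoint x → g x = 0 := by
    rintro x ⟨e, k, hk, rfl⟩
    rw [← pt_eq hk, hg e _ hk, height_vertex]
  have key : ∀ a b, Straight γ v a b → 0 ≤ a → b ≤ 1 → g (γ a) = a * v.im →
      g (γ b) = b * v.im := by
    intro a b hab
    induction hab with
    | @piece a b e z hab h' =>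
      intro ha hb hga
      obtain ⟨m1, e1⟩ := h' a ⟨le_rfl, hab⟩
      obtain ⟨m2, e2⟩ := h' b ⟨hab, le_rfl⟩
      rw [e1, hg e _ m1] at hga
      have him : (z + ((b - a : ℝ) : ℂ) * v).im - (z + ((a - a : ℝ) : ℂ) * v).im =
          (b - a) * v.im := by
        simp only [Complex.add_im, Complex.im_ofReal_mul]; ring
      rw [e2, hg e _ m2, height_add m1 m2 (by nlinarith) (by rw [him]; nlinarith), hga, him]
      ring
    | trans h₁ h₂ ih₁ ih₂ =>
      intro ha hb hga
      exact ih₂ (ha.trans h₁.le) hb (ih₁ ha (h₂.le.trans hb) hga)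
  have := key 0 1 hs le_rfl le_rfl (by rw [hcone _ h0, zero_mul])
  rw [hcone _ h1] at this
  linarith

lemma sin_le_abs_im_of_mem_holonomy {v : ℂ} (hv : v ∈ holonomy) (h : v.im ≠ 0) :
    Real.sin (Real.pi / 7) ≤ |v.im| := by
  rcases h.lt_or_gt with h | h
  · rw [abs_of_neg h]
    exact sin_le_im_of_mem_holonomy (neg_mem_holonomy hv) (by simpa using h)
  · rw [abs_of_pos h]
    exact sin_le_im_of_mem_holonomy hv h

/-! ### The horizontal strips of the heptagon `true` -/

/-- The direction of the normal to the side `c` of the heptagon `true`, measured from the vertical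
axis. -/
def normalAngle (c : ℕ) : ℝ := (2 * c + 1) * Real.pi / 7

/-- Half the width, at height `y`, of the trapezoid between the vertices `c`, `c + 1` of the
heptagon `true` and their mirror images. -/
def halfWidth (c : ℕ) (y : ℝ) : ℝ :=
  (circumradius * Real.cos (Real.pi / 7) - Real.cos (normalAngle c) * y) / Real.sin (normalAngle c)

/-- The circumference of the horizontal cylinder that contains this trapezoid. -/
def period (c : ℕ) : ℝ := 2 * (width c + width (c + 1))

/-- The translation that glues the right side of the trapezoid. -/
def shift (c : ℕ) : ℂ := ⟨width c + width (c + 1), level c + level (c + 1)⟩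

/-- The horizontal strip that contains the trapezoid. -/
def strip (c : ℕ) : Set ℂ := {z | level (c + 1) ≤ z.im ∧ z.im ≤ level c}

lemma sin_normalAngle_pos {c : ℕ} (hc : c ≤ 2) : 0 < Real.sin (normalAngle c) := by
  have hpi := Real.pi_pos
  have hc' : (c : ℝ) ≤ 2 := by exact_mod_cast hc
  apply Real.sin_pos_of_pos_of_lt_pi
  · rw [normalAngle]; positivity
  · rw [normalAngle]; nlinarith

lemma level_eq (c : ℕ) :
    level c = circumradius * (Real.cos (normalAngle c) * Real.cos (Real.pi / 7) +
      Real.sin (normalAngle c) * Real.sin (Real.pi / 7)) := by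
  rw [← Real.cos_sub, level, normalAngle]
  congr 2; ring

lemma level_succ_eq (c : ℕ) :
    level (c + 1) = circumradius * (Real.cos (normalAngle c) * Real.cos (Real.pi / 7) -
      Real.sin (normalAngle c) * Real.sin (Real.pi / 7)) := by
  rw [← Real.cos_add, level, normalAngle]
  congr 2; push_cast; ring

lemma width_eq (c : ℕ) :
    width c = circumradius * (Real.sin (normalAngle c) * Real.cos (Real.pi / 7) -
      Real.cos (normalAngle c) * Real.sin (Real.pi / 7)) := by
  rw [← Real.sin_sub, width, normalAngle]
  congr 2; ring

lemma width_succ_eq (c : ℕ) :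
    width (c + 1) = circumradius * (Real.sin (normalAngle c) * Real.cos (Real.pi / 7) +
      Real.cos (normalAngle c) * Real.sin (Real.pi / 7)) := by
  rw [← Real.sin_add, width, normalAngle]
  congr 2; push_cast; ring

/-- With ν = `normalAngle c`, the side from `c` to `c + 1` lies, up to mirror image, on the line x
sin ν + y cos ν = R cos(π/7), where R is the circumradius; its ends are at the angles ν ∓ π/7. -/
lemma halfWidth_level {c : ℕ} (hc : c ≤ 2) : halfWidth c (level c) = width c := by
  have h := (sin_normalAngle_pos hc).ne'
  rw [halfWidth, level_eq, width_eq]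
  field_simp
  linear_combination -circumradius * Real.cos (Real.pi / 7) * Real.sin_sq_add_cos_sq (normalAngle c)

lemma halfWidth_level_succ {c : ℕ} (hc : c ≤ 2) :
    halfWidth c (level (c + 1)) = width (c + 1) := by
  have h := (sin_normalAngle_pos hc).ne'
  rw [halfWidth, level_succ_eq, width_succ_eq]
  field_simp
  linear_combination -circumradius * Real.cos (Real.pi / 7) * Real.sin_sq_add_cos_sq (normalAngle c)

lemma halfWidth_combo (c : ℕ) {a b : ℝ} (hab : a + b = 1) (y y' : ℝ) :
    halfWidth c (a * y + b * y') = a * halfWidth c y + b * halfWidth c y' := by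
  obtain rfl : b = 1 - a := by linarith
  simp only [halfWidth, div_eq_mul_inv]; ring

/-- The half turn about the midpoint of the strip matches the trapezoids of the two heptagons: at
each height their widths add up to the circumference. -/
lemma halfWidth_reflect {c : ℕ} (hc : c ≤ 2) (y : ℝ) :
    halfWidth c (level c + level (c + 1) - y) = period c / 2 - halfWidth c y := by
  have h : level c + level (c + 1) - y = 1 * level c + 0 * level c + (level (c + 1) - y) := by ring
  have h1 := halfWidth_level hc
  have h2 := halfWidth_level_succ hc
  have h3 : halfWidth c (level c + level (c + 1) - y) =
      halfWidth c (level c) + halfWidth c (level (c + 1)) - halfWidth c y := by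
    simp only [halfWidth, div_eq_mul_inv]; ring
  rw [h3, h1, h2, period]; ring

/-- All three cylinders have the same ratio of circumference to height. This is why one shear acts
as a single twist on each. -/
lemma α_mul_level_sub {c : ℕ} : α * (level c - level (c + 1)) = period c := by
  have h := sin_pi_div_seven_pos.ne'
  rw [level_eq, level_succ_eq, period, width_eq, width_succ_eq, α, Real.cot_eq_cos_div_sin]
  field_simp
  ring

lemma exists_combo_of_mem_strip {c : ℕ} (hc : c ≤ 2) {z : ℂ} (hz : z ∈ strip c) :
    ∃ a b : ℝ, 0 ≤ a ∧ 0 ≤ b ∧ a + b = 1 ∧ z.im = a * level c + b * level (c + 1) ∧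
      halfWidth c z.im = a * width c + b * width (c + 1) := by
  have hl : 0 < level c - level (c + 1) := by
    linarith [level_lt (Nat.lt_succ_self c) (by omega)]
  refine ⟨(z.im - level (c + 1)) / (level c - level (c + 1)),
    (level c - z.im) / (level c - level (c + 1)), div_nonneg (by linarith [hz.1]) hl.le,
    div_nonneg (by linarith [hz.2]) hl.le, by field_simp; ring, by field_simp; ring, ?_⟩
  rw [← halfWidth_level hc, ← halfWidth_level_succ hc, ← halfWidth_combo]
  · congr 1; field_simp; ring
  · field_simp; ring

lemma width_nonneg {c : ℕ} (hc : c ≤ 3) : 0 ≤ width c := by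
  rcases Nat.eq_zero_or_pos c with rfl | h
  · rw [width_zero]
  · exact (width_pos h hc).le

lemma period_pos {c : ℕ} (hc : c ≤ 2) : 0 < period c := by
  have h1 := width_nonneg (c := c) (by omega)
  have h2 := width_pos (n := c + 1) (by omega) (by omega)
  rw [period]; linarith

lemma halfWidth_nonneg {c : ℕ} (hc : c ≤ 2) {z : ℂ} (hz : z ∈ strip c) :
    0 ≤ halfWidth c z.im := by
  obtain ⟨a, b, ha, hb, -, -, h⟩ := exists_combo_of_mem_strip hc hz
  have h1 := width_nonneg (c := c) (by omega)
  have h2 := width_nonneg (c := c + 1) (by omega)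
  rw [h]; positivity

lemma halfWidth_le {c : ℕ} (hc : c ≤ 2) {z : ℂ} (hz : z ∈ strip c) :
    halfWidth c z.im ≤ period c / 2 := by
  have h := halfWidth_nonneg hc (z := ⟨0, level c + level (c + 1) - z.im⟩)
    ⟨by simp only; linarith [hz.2], by simp only; linarith [hz.1]⟩
  simp only [halfWidth_reflect hc] at h
  linarith

lemma cos_le_cos_pi_div_seven {x : ℝ} (h1 : Real.pi / 7 ≤ x) (h2 : x ≤ 2 * Real.pi - Real.pi / 7) :
    Real.cos x ≤ Real.cos (Real.pi / 7) := by
  have hpi := Real.pi_pos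
  rcases le_total x Real.pi with h | h
  · exact Real.cos_le_cos_of_nonneg_of_le_pi (by positivity) h h1
  · rw [← Real.cos_two_pi_sub]
    exact Real.cos_le_cos_of_nonneg_of_le_pi (by positivity) (by linarith) (by linarith)

/-- Convexity reduces this to the vertices. Their directions differ from the normal of the side by
at least π/7, so none lies beyond the line of the side or its mirror image. -/
lemma abs_re_le_halfWidth {c : ℕ} (hc : c ≤ 2) {z : ℂ} (hz : z ∈ heptagon true) :
    -halfWidth c z.im ≤ z.re ∧ z.re ≤ halfWidth c z.im := by
  have hs := sin_normalAngle_pos hc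
  have hpi := Real.pi_pos
  have hc' : (c : ℝ) ≤ 2 := by exact_mod_cast hc
  have hc0 : (0 : ℝ) ≤ c := by positivity
  have hconv : Convex ℝ {z : ℂ | -halfWidth c z.im ≤ z.re ∧ z.re ≤ halfWidth c z.im} := by
    rintro x ⟨hx1, hx2⟩ y ⟨hy1, hy2⟩ a b ha hb hab
    simp only [mem_ofPred_eq, Complex.add_im, Complex.add_re, Complex.smul_re, Complex.smul_im,
      smul_eq_mul, halfWidth_combo c hab]
    constructor <;> nlinarith
  have hplus : ∀ j : ℕ, j ≤ 3 → width j ≤ halfWidth c (level j) := by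
    intro j hj
    have hj' : (j : ℝ) ≤ 3 := by exact_mod_cast hj
    rw [halfWidth, le_div_iff₀ hs]
    have h : Real.cos (2 * Real.pi * j / 7 - normalAngle c) ≤ Real.cos (Real.pi / 7) := by
      rcases le_or_gt j c with h | h
      · have h' : (j : ℝ) ≤ c := by exact_mod_cast h
        have h0 : (0 : ℝ) ≤ j := by positivity
        rw [← Real.cos_neg]
        apply cos_le_cos_pi_div_seven <;> rw [normalAngle] <;> nlinarith
      · have h' : (c : ℝ) + 1 ≤ j := by exact_mod_cast h
        apply cos_le_cos_pi_div_seven <;> rw [normalAngle] <;> nlinarith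
    rw [Real.cos_sub] at h
    have := mul_le_mul_of_nonneg_left h circumradius_pos.le
    rw [width, level]; linarith
  have hminus : ∀ j : ℕ, j ≤ 3 → -width j ≤ halfWidth c (level j) := by
    intro j hj
    have hj' : (j : ℝ) ≤ 3 := by exact_mod_cast hj
    rw [halfWidth, le_div_iff₀ hs]
    have h : Real.cos (2 * Real.pi * j / 7 + normalAngle c) ≤ Real.cos (Real.pi / 7) := by
      have h0 : (0 : ℝ) ≤ j := by positivity
      apply cos_le_cos_pi_div_seven <;> rw [normalAngle] <;> nlinarith
    rw [Real.cos_add] at h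
    have := mul_le_mul_of_nonneg_left h circumradius_pos.le
    rw [width, level]; linarith
  have key : ∀ j : ℕ, j ≤ 3 → ∀ k : Fin 7, level k = level j →
      (width k = width j ∨ width k = -width j) →
      -halfWidth c (vertex true k).im ≤ (vertex true k).re ∧
        (vertex true k).re ≤ halfWidth c (vertex true k).im := by
    intro j hj k hk hk'
    have h1 := hplus j hj
    have h2 := hminus j hj
    rw [vertex_true]
    simp only [hk]
    rcases hk' with h | h <;> rw [h] <;> constructor <;> linarith
  refine heptagon_subset_of_convex hconv (fun k => ?_) hz
  fin_cases k
  · exact key 0 (by norm_num) _ rfl (.inl rfl)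
  · exact key 1 (by norm_num) _ rfl (.inl rfl)
  · exact key 2 (by norm_num) _ rfl (.inl rfl)
  · exact key 3 (by norm_num) _ rfl (.inl rfl)
  · exact key 3 (by norm_num) _ level_four (.inr width_four)
  · exact key 2 (by norm_num) _ level_five (.inr width_five)
  · exact key 1 (by norm_num) _ level_six (.inr width_six)

lemma exists_left_side {c : ℕ} (hc : c ≤ 2) :
    ∃ k : Fin 7, vertex true k = ⟨-width c, level c⟩ ∧
      vertex true (k + 1) = ⟨-width (c + 1), level (c + 1)⟩ := by
  interval_cases c
  · exact ⟨0, vertex_true 0, vertex_true 1⟩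
  · exact ⟨1, vertex_true 1, vertex_true 2⟩
  · exact ⟨2, vertex_true 2, vertex_true 3⟩

lemma vertex_true_neg {n : ℕ} (k : Fin 7) (h : (k : ℕ) + n = 7) :
    vertex true k = ⟨width n, level n⟩ := by
  rw [vertex_true, width_sub h, level_sub h, neg_neg]

lemma exists_right_side {c : ℕ} (hc : c ≤ 2) :
    ∃ k : Fin 7, vertex true k = ⟨width (c + 1), level (c + 1)⟩ ∧
      vertex true (k + 1) = ⟨width c, level c⟩ := by
  interval_cases c
  · exact ⟨6, vertex_true_neg 6 rfl, by
      change vertex true 0 = _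
      rw [vertex_true, width_zero]
      simp [width_zero]⟩
  · exact ⟨5, vertex_true_neg 5 rfl, vertex_true_neg 6 rfl⟩
  · exact ⟨4, vertex_true_neg 4 rfl, vertex_true_neg 5 rfl⟩

lemma mem_left_side {c : ℕ} (hc : c ≤ 2) {z : ℂ} (hz : z ∈ strip c)
    (h : z.re = -halfWidth c z.im) : ∃ k, z ∈ side true k ∧ gluing true k = shift c - period c := by
  obtain ⟨k, h1, h2⟩ := exists_left_side hc
  obtain ⟨a, b, ha, hb, hab, him, hw⟩ := exists_combo_of_mem_strip hc hz
  refine ⟨k, ⟨a, b, ha, hb, hab, ?_⟩, ?_⟩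
  · rw [h1, h2]
    apply Complex.ext
    · rw [h, hw]; simp; ring
    · rw [him]; simp
  · rw [gluing, h1, h2, shift, period]
    apply Complex.ext <;> simp
    ring

lemma mem_right_side {c : ℕ} (hc : c ≤ 2) {z : ℂ} (hz : z ∈ strip c)
    (h : z.re = halfWidth c z.im) : ∃ k, z ∈ side true k ∧ gluing true k = shift c := by
  obtain ⟨k, h1, h2⟩ := exists_right_side hc
  obtain ⟨a, b, ha, hb, hab, him, hw⟩ := exists_combo_of_mem_strip hc hz
  refine ⟨k, ⟨b, a, hb, ha, by linarith, ?_⟩, ?_⟩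
  · rw [h1, h2]
    apply Complex.ext
    · rw [h, hw]; simp; ring
    · rw [him]; simp; ring
  · rw [gluing, h1, h2, shift]
    apply Complex.ext <;> simp <;> ring

lemma mem_heptagon_of_mem_strip {c : ℕ} (hc : c ≤ 2) {z : ℂ} (hz : z ∈ strip c)
    (h1 : -halfWidth c z.im ≤ z.re) (h2 : z.re ≤ halfWidth c z.im) : z ∈ heptagon true := by
  obtain ⟨k, hk, -⟩ := mem_left_side hc (z := ⟨-halfWidth c z.im, z.im⟩) hz rfl
  obtain ⟨l, hl, -⟩ := mem_right_side hc (z := ⟨halfWidth c z.im, z.im⟩) hz rfl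
  -- If the horizontal chord shrinks to a point, the weights used below would divide by zero.
  rcases eq_or_lt_of_le (halfWidth_nonneg hc hz) with h0 | h0
  · have : z = ⟨halfWidth c z.im, z.im⟩ := Complex.ext (by simp only; linarith) rfl
    rw [this]
    exact side_subset _ _ hl
  · have hw := h0.ne'
    refine (convex_heptagon true).segment_subset (side_subset _ _ hk) (side_subset _ _ hl)
      ⟨(halfWidth c z.im - z.re) / (2 * halfWidth c z.im),
        (z.re + halfWidth c z.im) / (2 * halfWidth c z.im), div_nonneg (by linarith) (by linarith),
        div_nonneg (by linarith) (by linarith), by field_simp; ring, ?_⟩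
    apply Complex.ext
    · simp only [Complex.add_re, Complex.smul_re, smul_eq_mul]; field_simp; ring
    · simp only [Complex.add_im, Complex.smul_im, smul_eq_mul]; field_simp; ring

/-! ### The horizontal cylinders -/

/-- The projection of two turns of the universal cover of a cylinder to the surface. -/
def cyl (c : ℕ) (z : ℂ) : Surface :=
  if z.re ≤ halfWidth c z.im then pt true z
  else if z.re ≤ period c - halfWidth c z.im then pt false (z - shift c)
  else if z.re ≤ period c + halfWidth c z.im then pt true (z - period c)
  else pt false (z - period c - shift c)

lemma pt_right {c : ℕ} (hc : c ≤ 2) {z : ℂ} (hz : z ∈ strip c) (h : z.re = halfWidth c z.im) :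
    pt true z = pt false (z - shift c) := by
  obtain ⟨k, hk, hg⟩ := mem_right_side hc hz h
  rw [pt_glue hk, hg, Bool.not_true]

lemma pt_left {c : ℕ} (hc : c ≤ 2) {z : ℂ} (hz : z ∈ strip c) (h : z.re = -halfWidth c z.im) :
    pt true z = pt false (z + period c - shift c) := by
  obtain ⟨k, hk, hg⟩ := mem_left_side hc hz h
  rw [pt_glue hk, hg, Bool.not_true]
  congr 1; ring

lemma sub_period_re (c : ℕ) (z : ℂ) : (z - period c).re = z.re - period c := by simp

lemma sub_period_im (c : ℕ) (z : ℂ) : (z - period c).im = z.im := by simp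

lemma sub_period_mem_strip {c : ℕ} {z : ℂ} (hz : z ∈ strip c) : z - period c ∈ strip c := by
  simpa only [strip, mem_ofPred_eq, sub_period_im] using hz

lemma cyl_eq_one {c : ℕ} {z : ℂ} (h : z.re ≤ halfWidth c z.im) : cyl c z = pt true z := if_pos h

lemma cyl_eq_two {c : ℕ} {z : ℂ} (hc : c ≤ 2) (hz : z ∈ strip c)
    (h1 : halfWidth c z.im ≤ z.re) (h2 : z.re ≤ period c - halfWidth c z.im) :
    cyl c z = pt false (z - shift c) := by
  unfold cyl
  split_ifs with h
  · exact pt_right hc hz (le_antisymm h h1)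
  · rfl

lemma pt_sub_period {c : ℕ} {z : ℂ} (hc : c ≤ 2) (hz : z ∈ strip c)
    (h : z.re = period c - halfWidth c z.im) :
    pt true (z - period c) = pt false (z - shift c) := by
  rw [pt_left hc (sub_period_mem_strip hz) (by rw [sub_period_re, sub_period_im, h]; ring)]
  congr 1; ring

lemma cyl_eq_three {c : ℕ} {z : ℂ} (hc : c ≤ 2) (hz : z ∈ strip c)
    (h1 : period c - halfWidth c z.im ≤ z.re)
    (h2 : z.re ≤ period c + halfWidth c z.im) : cyl c z = pt true (z - period c) := by
  have hle := halfWidth_le hc hz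
  rcases eq_or_lt_of_le h1 with h | h
  · rw [cyl_eq_two hc hz (by linarith) h.symm.le, pt_sub_period hc hz h.symm]
  · rw [cyl, if_neg (by linarith), if_neg (by linarith), if_pos h2]

lemma cyl_eq_four {c : ℕ} {z : ℂ} (hc : c ≤ 2) (hz : z ∈ strip c)
    (h1 : period c + halfWidth c z.im ≤ z.re) :
    cyl c z = pt false (z - period c - shift c) := by
  have hp := period_pos hc
  have h0 := halfWidth_nonneg hc hz
  rcases eq_or_lt_of_le h1 with h | h
  · rw [cyl_eq_three hc hz (by linarith) h.symm.le,
      pt_right hc (sub_period_mem_strip hz) (by rw [sub_period_re, sub_period_im, ← h]; ring)]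
  · rw [cyl, if_neg (by linarith), if_neg (by linarith), if_neg (by linarith)]

lemma cyl_add_period {c : ℕ} {z : ℂ} (hc : c ≤ 2) (hz : z ∈ strip c)
    (h1 : -halfWidth c z.im ≤ z.re) (h2 : z.re ≤ period c - halfWidth c z.im) :
    cyl c (z + period c) = cyl c z := by
  have hre : (z + period c).re = z.re + period c := by simp
  have him : (z + period c).im = z.im := by simp
  have hz' : z + period c ∈ strip c := by
    simpa only [strip, mem_ofPred_eq, him] using hz
  rcases le_total z.re (halfWidth c z.im) with h | h
  · rw [cyl_eq_one h, cyl_eq_three hc hz' (by rw [hre, him]; linarith)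
      (by rw [hre, him]; linarith), add_sub_cancel_right]
  · rw [cyl_eq_two hc hz h h2, cyl_eq_four hc hz' (by rw [hre, him]; linarith),
      add_sub_cancel_right]

/-- The strip on the plane of the cylinder that corresponds to a point of a heptagon. -/
def dev (e : Bool) (c : ℕ) (z : ℂ) : ℂ := if e then z else z + shift c

lemma dev_add (e : Bool) (c : ℕ) (z w : ℂ) : dev e c (z + w) = dev e c z + w := by
  cases e
  · simp only [dev, Bool.false_eq_true, if_false]; ring
  · rfl

/-- `dev` places the parts of both heptagons in one fundamental domain of the cylinder; the heptagon
`false` is treated through its negative. -/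
lemma dev_bounds {e : Bool} {c : ℕ} (hc : c ≤ 2) {z : ℂ} (hz : z ∈ heptagon e)
    (hs : dev e c z ∈ strip c) :
    -halfWidth c (dev e c z).im ≤ (dev e c z).re ∧
      (dev e c z).re ≤ period c - halfWidth c (dev e c z).im := by
  cases e
  · have h := abs_re_le_halfWidth hc (z := -z) (neg_mem_heptagon (e := false) |>.2 hz)
    have h0 := halfWidth_nonneg hc hs
    have hr := halfWidth_reflect hc (-z).im
    have him : level c + level (c + 1) - (-z).im = (dev false c z).im := by
      simp [dev, shift]; ring
    have hre : (dev false c z).re = z.re + period c / 2 := by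
      simp [dev, shift, period]
    rw [him] at hr
    rw [Complex.neg_re] at h
    rw [hre]
    constructor <;> linarith [h.1, h.2]
  · have h := abs_re_le_halfWidth hc hz
    have := halfWidth_le hc hs
    simp only [dev, if_true] at this ⊢
    constructor <;> linarith [h.1, h.2]

lemma cyl_dev {e : Bool} {c : ℕ} (hc : c ≤ 2) {z : ℂ} (hz : z ∈ heptagon e)
    (hs : dev e c z ∈ strip c) : cyl c (dev e c z) = pt e z := by
  cases e
  · have h := abs_re_le_halfWidth hc (z := -z) (neg_mem_heptagon (e := false) |>.2 hz)
    have hb := dev_bounds hc hz hs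
    have hr := halfWidth_reflect hc (-z).im
    have him : level c + level (c + 1) - (-z).im = (dev false c z).im := by
      simp [dev, shift]; ring
    have hre : (dev false c z).re = z.re + period c / 2 := by
      simp [dev, shift, period]
    rw [him] at hr
    rw [Complex.neg_re] at h
    rw [cyl_eq_two hc hs (by rw [hre]; linarith [h.2]) hb.2]
    simp [dev]
  · exact cyl_eq_one (abs_re_le_halfWidth hc hz).2

lemma mem_heptagon_false {c : ℕ} (hc : c ≤ 2) {z : ℂ} (hz : z ∈ strip c)
    (h1 : halfWidth c z.im ≤ z.re) (h2 : z.re ≤ period c - halfWidth c z.im) :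
    z - shift c ∈ heptagon false := by
  have h : -(z - shift c) ∈ heptagon true := by
    have him : (-(z - shift c)).im = level c + level (c + 1) - z.im := by
      simp [shift]
    have hre : (-(z - shift c)).re = period c / 2 - z.re := by
      simp [shift, period]
    apply mem_heptagon_of_mem_strip hc
    · simp only [strip, mem_ofPred_eq, him]
      exact ⟨by linarith [hz.2], by linarith [hz.1]⟩
    · rw [him, hre, halfWidth_reflect hc]; linarith
    · rw [him, hre, halfWidth_reflect hc]; linarith
  exact (neg_mem_heptagon (e := false)).1 h

/-! ### The Dehn twist -/

/-- The shear with matrix rows `(1, α)` and `(0, 1)`. -/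
def σ (z : ℂ) : ℂ := z + ((α * z.im : ℝ) : ℂ)

/-- The twist of the cylinder `c`, on the universal cover. -/
def twistStrip (c : ℕ) (z : ℂ) : ℂ := z + ((α * (z.im - level (c + 1)) : ℝ) : ℂ)

lemma twistStrip_re (c : ℕ) (z : ℂ) :
    (twistStrip c z).re = z.re + α * (z.im - level (c + 1)) := by simp [twistStrip]

lemma twistStrip_im (c : ℕ) (z : ℂ) : (twistStrip c z).im = z.im := by
  simp [twistStrip, -Complex.ofReal_mul, -Complex.ofReal_sub]

lemma twistStrip_add (c : ℕ) (z v : ℂ) (t : ℝ) :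
    twistStrip c (z + (t : ℂ) * v) = twistStrip c z + (t : ℂ) * σ v := by
  simp only [twistStrip, σ, Complex.add_im, Complex.im_ofReal_mul]
  push_cast; ring

lemma α_pos : 0 < α := by
  have h1 := sin_pi_div_seven_pos
  have h2 := cos_pi_div_seven_pos
  rw [α, Real.cot_eq_cos_div_sin]; positivity

/-- The image under the twist of a point of the heptagon `e` in the strip `c`. -/
def twistIn (e : Bool) (c : ℕ) (z : ℂ) : Surface := cyl c (twistStrip c (dev e c z))

/-- The twist moves points to the right by at most one period, so the two turns covered by `cyl`
suffice. -/
lemma twistStrip_bounds {e : Bool} {c : ℕ} (hc : c ≤ 2) {z : ℂ} (hz : z ∈ heptagon e)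
    (hs : dev e c z ∈ strip c) :
    twistStrip c (dev e c z) ∈ strip c ∧
    -halfWidth c (twistStrip c (dev e c z)).im ≤ (twistStrip c (dev e c z)).re ∧
      (twistStrip c (dev e c z)).re ≤ 2 * period c - halfWidth c (twistStrip c (dev e c z)).im := by
  have h := dev_bounds hc hz hs
  have hα := α_pos
  have hp := α_mul_level_sub (c := c)
  rw [twistStrip_re, twistStrip_im]
  refine ⟨by simpa only [strip, mem_ofPred_eq, twistStrip_im] using hs, ?_, ?_⟩
  · nlinarith [h.1, hs.1]
  · nlinarith [h.2, hs.2]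

/-- The twist moves the bottom circle by 0 and the top circle by a full period. It is therefore the
identity on the boundary, and the twists of different cylinders fit together. -/
lemma twistIn_eq_of_boundary {e : Bool} {c : ℕ} (hc : c ≤ 2) {z : ℂ} (hz : z ∈ heptagon e)
    (hs : (dev e c z).im = level c ∨ (dev e c z).im = level (c + 1)) :
    twistIn e c z = pt e z := by
  have hl := level_lt (Nat.lt_succ_self c) (by omega)
  rcases hs with h | h
  · have hs : dev e c z ∈ strip c := ⟨by rw [h]; exact hl.le, h.le⟩
    have hb := dev_bounds hc hz hs
    rw [twistIn, twistStrip, h, α_mul_level_sub, cyl_add_period hc hs hb.1 hb.2, cyl_dev hc hz hs]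
  · have hs : dev e c z ∈ strip c := ⟨h.symm.le, by rw [h]; exact hl.le⟩
    rw [twistIn, twistStrip, h, sub_self, mul_zero, Complex.ofReal_zero, add_zero,
      cyl_dev hc hz hs]

/-- The Dehn twist of all horizontal cylinders, on the heptagons. -/
def twist (e : Bool) (z : ℂ) : Surface :=
  open Classical in
  if dev e 0 z ∈ strip 0 then twistIn e 0 z
  else if dev e 1 z ∈ strip 1 then twistIn e 1 z
  else twistIn e 2 z

lemma dev_im (e : Bool) (c : ℕ) (z : ℂ) :
    (dev e c z).im = if e then z.im else z.im + (level c + level (c + 1)) := by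
  cases e <;> simp [dev, shift]

lemma exists_dev_mem_strip {e : Bool} {z : ℂ} (hz : z ∈ heptagon e) :
    ∃ c ≤ 2, dev e c z ∈ strip c := by
  simp only [strip, mem_ofPred_eq, dev_im]
  cases e
  · have h := im_mem_of_mem_heptagon_false hz
    rcases le_total z.im (-level 1) with h1 | h1
    · exact ⟨0, by norm_num, by norm_num; constructor <;> linarith [h.1]⟩
    rcases le_total z.im (-level 2) with h2 | h2
    · exact ⟨1, by norm_num, by norm_num; constructor <;> linarith⟩
    · exact ⟨2, by norm_num, by norm_num; constructor <;> linarith [h.2]⟩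
  · have h := im_mem_of_mem_heptagon hz
    rcases le_total z.im (level 1) with h1 | h1
    · rcases le_total z.im (level 2) with h2 | h2
      · exact ⟨2, by norm_num, h.1, h2⟩
      · exact ⟨1, by norm_num, h2, h1⟩
    · exact ⟨0, by norm_num, h1, h.2⟩

/-- The cylinders 0, 1, 2 are stacked downwards in the heptagon `true` and upwards in `false`,
whence the two alternatives. -/
lemma boundary_of_mem_two_strips {e : Bool} {z : ℂ} {c c' : ℕ} (hlt : c < c') (hc' : c' ≤ 2)
    (h : dev e c z ∈ strip c) (h' : dev e c' z ∈ strip c') :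
    (dev e c z).im = level (c + 1) ∧ (dev e c' z).im = level c' ∨
      (dev e c z).im = level c ∧ (dev e c' z).im = level (c' + 1) := by
  have h1 := level_one_lt
  have h2 := level_two_lt
  have h3 := level_three_lt
  simp only [strip, mem_ofPred_eq, dev_im] at *
  obtain ⟨rfl, rfl⟩ | ⟨rfl, rfl⟩ | ⟨rfl, rfl⟩ :
    c = 0 ∧ c' = 1 ∨ c = 0 ∧ c' = 2 ∨ c = 1 ∧ c' = 2 := by omega
  all_goals
    norm_num only at *
    cases e
    · simp only [Bool.false_eq_true, if_false] at *
      first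
        | exfalso; linarith [h.1, h.2, h'.1, h'.2]
        | right; constructor <;> linarith [h.1, h.2, h'.1, h'.2]
    · simp only [if_true] at *
      first
        | exfalso; linarith [h.1, h.2, h'.1, h'.2]
        | left; constructor <;> linarith [h.1, h.2, h'.1, h'.2]

lemma twistIn_eq_twistIn {e : Bool} {z : ℂ} {c c' : ℕ} (hlt : c < c') (hc' : c' ≤ 2)
    (hz : z ∈ heptagon e) (h : dev e c z ∈ strip c) (h' : dev e c' z ∈ strip c') :
    twistIn e c z = twistIn e c' z := by
  have hb := boundary_of_mem_two_strips hlt hc' h h'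
  rw [twistIn_eq_of_boundary (by omega) hz (by tauto), twistIn_eq_of_boundary hc' hz (by tauto)]

lemma twist_eq {e : Bool} {z : ℂ} {c : ℕ} (hc : c ≤ 2) (hz : z ∈ heptagon e)
    (h : dev e c z ∈ strip c) : twist e z = twistIn e c z := by
  unfold twist
  split_ifs with h0 h1
  · rcases Nat.eq_zero_or_pos c with rfl | hc0
    · rfl
    · exact twistIn_eq_twistIn hc0 hc hz h0 h
  · obtain rfl | rfl | rfl : c = 0 ∨ c = 1 ∨ c = 2 := by omega
    · exact absurd h h0
    · rfl
    · exact twistIn_eq_twistIn (by norm_num) hc hz h1 h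
  · obtain rfl | rfl | rfl : c = 0 ∨ c = 1 ∨ c = 2 := by omega
    · exact absurd h h0
    · exact absurd h h1
    · rfl

lemma side_cases {k : Fin 7} {z : ℂ} (hz : z ∈ side true k) :
    (∃ c ≤ 2, z ∈ strip c ∧ (gluing true k = shift c ∨ gluing true k = shift c - period c)) ∨
      z.im = level 3 ∧ (gluing true k).im = 2 * level 3 := by
  obtain ⟨a, b, ha, hb, hab, -, him⟩ := exists_of_mem_side hz
  obtain rfl : b = 1 - a := by linarith
  have h1 := level_one_lt
  have h2 := level_two_lt
  have h3 := level_three_lt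
  have left : ∀ c ≤ 2, vertex true k = ⟨-width c, level c⟩ →
      vertex true (k + 1) = ⟨-width (c + 1), level (c + 1)⟩ →
      ∃ c ≤ 2, z ∈ strip c ∧ (gluing true k = shift c ∨ gluing true k = shift c - period c) := by
    intro c hc e1 e2
    have hl := level_lt (Nat.lt_succ_self c) (by omega)
    have i1 : level k = level c := by simpa [vertex_true] using congrArg Complex.im e1
    have i2 : level (k + 1 : Fin 7) = level (c + 1) := by
      simpa [vertex_true] using congrArg Complex.im e2
    rw [i1, i2] at him
    refine ⟨c, hc, ⟨by nlinarith, by nlinarith⟩, .inr ?_⟩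
    rw [gluing, e1, e2, shift, period]
    apply Complex.ext <;> simp
    ring
  have right : ∀ c ≤ 2, vertex true k = ⟨width (c + 1), level (c + 1)⟩ →
      vertex true (k + 1) = ⟨width c, level c⟩ →
      ∃ c ≤ 2, z ∈ strip c ∧ (gluing true k = shift c ∨ gluing true k = shift c - period c) := by
    intro c hc e1 e2
    have hl := level_lt (Nat.lt_succ_self c) (by omega)
    have i1 : level k = level (c + 1) := by simpa [vertex_true] using congrArg Complex.im e1
    have i2 : level (k + 1 : Fin 7) = level c := by
      simpa [vertex_true] using congrArg Complex.im e2
    rw [i1, i2] at him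
    refine ⟨c, hc, ⟨by nlinarith, by nlinarith⟩, .inl ?_⟩
    rw [gluing, e1, e2, shift]
    apply Complex.ext <;> simp <;> ring
  have e0 : vertex true 0 = ⟨width 0, level 0⟩ := by
    rw [vertex_true]; simp [width_zero]
  have e4 := level_four
  have hg := im_gluing k
  fin_cases k
  · exact .inl (left 0 (by norm_num) (vertex_true 0) (vertex_true 1))
  · exact .inl (left 1 (by norm_num) (vertex_true 1) (vertex_true 2))
  · exact .inl (left 2 (by norm_num) (vertex_true 2) (vertex_true 3))
  · right
    change z.im = a * level 3 + (1 - a) * level 4 at him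
    change (gluing true 3).im = level 3 + level 4 at hg
    change z.im = level 3 ∧ (gluing true 3).im = 2 * level 3
    rw [e4] at him hg
    exact ⟨by linarith, by linarith⟩
  · exact .inl (right 2 (by norm_num) (vertex_true_neg 4 rfl) (vertex_true_neg 5 rfl))
  · exact .inl (right 1 (by norm_num) (vertex_true_neg 5 rfl) (vertex_true_neg 6 rfl))
  · exact .inl (right 0 (by norm_num) (vertex_true_neg 6 rfl) e0)

/-- Across a right side the two developments agree, and across a left side they differ by one
period, which `cyl_add_period` absorbs. The horizontal side is on the boundary of cylinder 2, where
the twist is the identity. -/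
lemma twist_glue (k : Fin 7) (z : ℂ) (hz : z ∈ side true k) :
    twist true z = twist false (z - gluing true k) := by
  have hm := side_subset _ _ hz
  have hm' : z - gluing true k ∈ heptagon false :=
    side_subset false k (sub_gluing_mem_side (e := true) hz)
  rcases side_cases hz with ⟨c, hc, hs, hg | hg⟩ | ⟨h1, h2⟩
  · have hd : dev false c (z - gluing true k) = z := by simp [dev, hg]
    rw [twist_eq hc hm hs, twist_eq hc hm' (by rwa [hd]), twistIn, twistIn, hd]
    rfl
  · have hd : dev false c (z - gluing true k) = z + period c := by
      simp only [dev, hg, Bool.false_eq_true, if_false]; ring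
    have hp : (z + period c).im = z.im := by simp
    have hs' : dev false c (z - gluing true k) ∈ strip c := by
      rw [hd]
      simpa only [strip, mem_ofPred_eq, hp] using hs
    have hb := dev_bounds hc hm' hs'
    rw [hd, hp] at hb
    have hre : (z + period c).re = z.re + period c := by simp
    rw [hre] at hb
    have hb1 := twistStrip_bounds hc hm hs
    have hα := α_mul_level_sub (c := c)
    have hpos := α_pos
    have e1 : twistStrip c (z + period c) = twistStrip c z + period c := by
      simp only [twistStrip, hp]; ring
    rw [twist_eq hc hm hs, twist_eq hc hm' hs', twistIn, twistIn, hd, e1]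
    -- Here `hb.2` puts `z` at or left of the left edge, so after at most one period of twisting it
    -- is still in the first fundamental domain.
    refine (cyl_add_period hc hb1.1 hb1.2.1 ?_).symm
    change (twistStrip c z).re ≤ period c - halfWidth c (twistStrip c z).im
    rw [twistStrip_re, twistStrip_im]
    nlinarith [hb.2, hs.2]
  · have hl := level_three_lt
    have hs : dev true 2 z ∈ strip 2 := by
      simp only [strip, mem_ofPred_eq, dev_im, if_true, h1]
      exact ⟨le_rfl, hl.le⟩
    have him : (dev false 2 (z - gluing true k)).im = level 2 := by
      rw [dev_im, Complex.sub_im, h1, h2]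
      norm_num; ring
    have hs' : dev false 2 (z - gluing true k) ∈ strip 2 := by
      simp only [strip, mem_ofPred_eq, him]
      exact ⟨hl.le, le_rfl⟩
    rw [twist_eq (by norm_num) hm hs, twist_eq (by norm_num) hm' hs',
      twistIn_eq_of_boundary (by norm_num) hm (.inr (by rw [dev_im, if_pos rfl, h1])),
      twistIn_eq_of_boundary (by norm_num) hm' (.inl him), pt_glue hz, Bool.not_true]

lemma height_eq_zero_of_isConePoint {e : Bool} {z : ℂ} (hz : z ∈ heptagon e)
    (h : IsConePoint (pt e z)) : height e z = 0 := by
  obtain ⟨k, rfl⟩ := mem_range_vertex_of_norm hz ((isConePoint_pt hz).1 h)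
  exact height_vertex e k

lemma height_eq_of_mem_interior {e : Bool} {z : ℂ} {c : ℕ} (hc : c ≤ 2)
    (h1 : level (c + 1) < (dev e c z).im) (h2 : (dev e c z).im < level c) :
    height e z = (dev e c z).im - level (c + 1) := by
  have l1 := level_one_lt
  have l2 := level_two_lt
  have l3 := level_three_lt
  rw [dev_im] at *
  obtain rfl | rfl | rfl : c = 0 ∨ c = 1 ∨ c = 2 := by omega
  all_goals
    cases e <;> simp only [height, Bool.false_eq_true, if_false, if_true] at * <;>
      norm_num only at * <;> split_ifs <;> linarith

lemma not_isConePoint_of_mem_interior {e : Bool} {z : ℂ} {c : ℕ} (hc : c ≤ 2)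
    (hz : z ∈ heptagon e) (h1 : level (c + 1) < (dev e c z).im)
    (h2 : (dev e c z).im < level c) : ¬ IsConePoint (pt e z) := by
  intro h
  have h3 := height_eq_zero_of_isConePoint hz h
  rw [height_eq_of_mem_interior hc h1 h2] at h3
  linarith

lemma exists_cyl_eq {c : ℕ} (hc : c ≤ 2) {w : ℂ} (hw : w ∈ strip c)
    (h1 : -halfWidth c w.im ≤ w.re) (h2 : w.re ≤ 2 * period c - halfWidth c w.im) :
    ∃ e, ∃ z ∈ heptagon e, cyl c w = pt e z ∧ (dev e c z).im = w.im := by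
  have hd : ∀ w : ℂ, (dev false c (w - shift c)).im = w.im := fun w => by simp [dev]
  rcases le_total w.re (halfWidth c w.im) with a1 | a1
  · exact ⟨true, w, mem_heptagon_of_mem_strip hc hw h1 a1, cyl_eq_one a1, rfl⟩
  rcases le_total w.re (period c - halfWidth c w.im) with a2 | a2
  · exact ⟨false, _, mem_heptagon_false hc hw a1 a2, cyl_eq_two hc hw a1 a2, hd w⟩
  rcases le_total w.re (period c + halfWidth c w.im) with a3 | a3
  · exact ⟨true, _, mem_heptagon_of_mem_strip hc (sub_period_mem_strip hw)
      (by rw [sub_period_re, sub_period_im]; linarith)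
      (by rw [sub_period_re, sub_period_im]; linarith), cyl_eq_three hc hw a2 a3,
      sub_period_im c w⟩
  · exact ⟨false, _, mem_heptagon_false hc (sub_period_mem_strip hw)
      (by rw [sub_period_re, sub_period_im]; linarith)
      (by rw [sub_period_re, sub_period_im]; linarith), cyl_eq_four hc hw a3,
      (hd _).trans (sub_period_im c w)⟩

/-- On the boundary of a cylinder the twist is the identity; inside it keeps the vertical
coordinate, and no cone point lies there. -/
lemma isConePoint_twist {e : Bool} {z : ℂ} (hz : z ∈ heptagon e) :
    IsConePoint (twist e z) ↔ IsConePoint (pt e z) := by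
  obtain ⟨c, hc, hs⟩ := exists_dev_mem_strip hz
  rw [twist_eq hc hz hs]
  by_cases hb : (dev e c z).im = level c ∨ (dev e c z).im = level (c + 1)
  · rw [twistIn_eq_of_boundary hc hz hb]
  · rw [not_or] at hb
    have h1 : level (c + 1) < (dev e c z).im := lt_of_le_of_ne hs.1 (Ne.symm hb.2)
    have h2 : (dev e c z).im < level c := lt_of_le_of_ne hs.2 hb.1
    obtain ⟨b1, b2, b3⟩ := twistStrip_bounds hc hz hs
    obtain ⟨e', z', hz', he, him⟩ := exists_cyl_eq hc b1 b2 b3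
    rw [twistStrip_im] at him
    rw [twistIn, he]
    exact iff_of_false
      (not_isConePoint_of_mem_interior hc hz' (by rw [him]; exact h1) (by rw [him]; exact h2))
      (not_isConePoint_of_mem_interior hc hz h1 h2)

/-! ### The twist maps straight paths to straight paths -/

lemma Straight.of_base {γ : ℝ → Surface} {v : ℂ} {a b s : ℝ} (e : Bool) (z : ℂ) (hab : a ≤ b)
    (h : ∀ t ∈ Icc a b, z + ((t - s : ℝ) : ℂ) * v ∈ heptagon e ∧
      γ t = pt e (z + ((t - s : ℝ) : ℂ) * v)) : Straight γ v a b := by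
  refine .piece e (z + ((a - s : ℝ) : ℂ) * v) hab fun t ht => ?_
  have e1 : z + ((a - s : ℝ) : ℂ) * v + ((t - a : ℝ) : ℂ) * v = z + ((t - s : ℝ) : ℂ) * v := by
    push_cast; ring
  rw [e1]
  exact h t ht

lemma Straight.of_cut {γ : ℝ → Surface} {v : ℂ} {a b : ℝ} (hab : a ≤ b) {g : ℝ → ℝ}
    (hg : ∃ p q, ∀ t, g t = p + q * t)
    (hneg : ∀ a' b', a ≤ a' → a' ≤ b' → b' ≤ b → (∀ t ∈ Icc a' b', g t ≤ 0) → Straight γ v a' b')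
    (hpos : ∀ a' b', a ≤ a' → a' ≤ b' → b' ≤ b → (∀ t ∈ Icc a' b', 0 ≤ g t) →
      Straight γ v a' b') : Straight γ v a b := by
  obtain ⟨p, q, hg⟩ := hg
  simp only [hg] at hneg hpos
  exact of_sign_cut (P := Straight γ v) .trans hab p q hneg hpos

lemma halfWidth_affine (c : ℕ) (y y' t : ℝ) :
    halfWidth c (y + t * y') = halfWidth c y + t * (halfWidth c y' - halfWidth c 0) := by
  simp only [halfWidth, div_eq_mul_inv]; ring

/-- `halfWidth` is affine in the height, so each test in the definition of `cyl` is affine in time.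
Cutting at its sign changes leaves pieces in single heptagons. -/
lemma straight_cyl {c : ℕ} (hc : c ≤ 2) {w v : ℂ} {s a b : ℝ} (hab : a ≤ b)
    (h : ∀ t ∈ Icc a b, w + ((t - s : ℝ) : ℂ) * v ∈ strip c ∧
      -halfWidth c (w + ((t - s : ℝ) : ℂ) * v).im ≤ (w + ((t - s : ℝ) : ℂ) * v).re ∧
      (w + ((t - s : ℝ) : ℂ) * v).re ≤ 2 * period c - halfWidth c (w + ((t - s : ℝ) : ℂ) * v).im) :
    Straight (fun t => cyl c (w + ((t - s : ℝ) : ℂ) * v)) v a b := by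
  have haff : ∀ x y : ℝ, ∃ p q, ∀ t : ℝ, (w + ((t - s : ℝ) : ℂ) * v).re - x +
      y * halfWidth c (w + ((t - s : ℝ) : ℂ) * v).im = p + q * t := fun x y => by
    refine ⟨w.re - s * v.re - x + y * halfWidth c w.im -
      y * s * (halfWidth c v.im - halfWidth c 0), v.re + y * (halfWidth c v.im - halfWidth c 0),
      fun t => ?_⟩
    simp only [Complex.add_re, Complex.add_im, Complex.re_ofReal_mul, Complex.im_ofReal_mul,
      halfWidth_affine]
    ring
  have hsub : ∀ (x : ℂ) (t : ℝ), w - x + ((t - s : ℝ) : ℂ) * v =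
      w + ((t - s : ℝ) : ℂ) * v - x := fun x t => by ring
  refine .of_cut hab (haff 0 (-1)) (fun a b i1 hab i2 h' => ?_) fun a b i1 hab i2 h1' => ?_
  · refine .of_base (s := s) true w hab fun t ht => ?_
    obtain ⟨b1, b2, b3⟩ := h t ⟨i1.trans ht.1, ht.2.trans i2⟩
    have := h' t ht
    exact ⟨mem_heptagon_of_mem_strip hc b1 b2 (by linarith), cyl_eq_one (by linarith)⟩
  replace h : ∀ t ∈ Icc a b, _ := fun t ht => h t ⟨i1.trans ht.1, ht.2.trans i2⟩
  clear i1 i2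
  refine .of_cut hab (haff (period c) 1) (fun a b i1 hab i2 h' => ?_)
    fun a b i1 hab i2 h2' => ?_
  · refine .of_base (s := s) false (w - shift c) hab fun t ht => ?_
    have ht' : t ∈ Icc _ _ := ⟨i1.trans ht.1, ht.2.trans i2⟩
    obtain ⟨b1, b2, b3⟩ := h t ht'
    have h1 := h1' t ht'
    have h2 := h' t ht
    rw [hsub]
    exact ⟨mem_heptagon_false hc b1 (by linarith) (by linarith),
      cyl_eq_two hc b1 (by linarith) (by linarith)⟩
  replace h : ∀ t ∈ Icc a b, _ := fun t ht => h t ⟨i1.trans ht.1, ht.2.trans i2⟩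
  clear i1 i2 h1'
  refine .of_cut hab (haff (period c) (-1)) (fun a b i1 hab i2 h' => ?_)
    fun a b i1 hab i2 h' => ?_
  · refine .of_base (s := s) true (w - period c) hab fun t ht => ?_
    have ht' : t ∈ Icc _ _ := ⟨i1.trans ht.1, ht.2.trans i2⟩
    obtain ⟨b1, b2, b3⟩ := h t ht'
    have h1 := h2' t ht'
    have h2 := h' t ht
    rw [hsub]
    exact ⟨mem_heptagon_of_mem_strip hc (sub_period_mem_strip b1)
      (by rw [sub_period_re, sub_period_im]; linarith)
      (by rw [sub_period_re, sub_period_im]; linarith),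
      cyl_eq_three hc b1 (by linarith) (by linarith)⟩
  · refine .of_base (s := s) false (w - period c - shift c) hab fun t ht => ?_
    have ht' : t ∈ Icc _ _ := ⟨i1.trans ht.1, ht.2.trans i2⟩
    obtain ⟨b1, b2, b3⟩ := h t ht'
    have h2 := h' t ht
    have e1 : w - period c - shift c + ((t - s : ℝ) : ℂ) * v =
      w + ((t - s : ℝ) : ℂ) * v - period c - shift c := by ring
    rw [e1]
    exact ⟨mem_heptagon_false hc (sub_period_mem_strip b1)
      (by rw [sub_period_re, sub_period_im]; linarith)
      (by rw [sub_period_re, sub_period_im]; linarith), cyl_eq_four hc b1 (by linarith)⟩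

lemma straight_twist_of_mem_strip {e : Bool} {c : ℕ} (hc : c ≤ 2) {z v : ℂ} {s a b : ℝ}
    (hab : a ≤ b) (h : ∀ t ∈ Icc a b, z + ((t - s : ℝ) : ℂ) * v ∈ heptagon e)
    (hs : ∀ t ∈ Icc a b, dev e c (z + ((t - s : ℝ) : ℂ) * v) ∈ strip c) :
    Straight (fun t => twist e (z + ((t - s : ℝ) : ℂ) * v)) (σ v) a b := by
  have e1 : ∀ t : ℝ, twistStrip c (dev e c (z + ((t - s : ℝ) : ℂ) * v)) =
      twistStrip c (dev e c z) + ((t - s : ℝ) : ℂ) * σ v := fun t => by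
    rw [dev_add, twistStrip_add]
  refine (straight_cyl hc (w := twistStrip c (dev e c z)) (v := σ v) (s := s) hab
    fun t ht => ?_).congr fun t ht => ?_
  · rw [← e1]
    exact twistStrip_bounds hc (h t ht) (hs t ht)
  · rw [twist_eq hc (h t ht) (hs t ht), twistIn, e1]

lemma straight_twist {e : Bool} {z v : ℂ} {s a b : ℝ} (hab : a ≤ b)
    (h : ∀ t ∈ Icc a b, z + ((t - s : ℝ) : ℂ) * v ∈ heptagon e) :
    Straight (fun t => twist e (z + ((t - s : ℝ) : ℂ) * v)) (σ v) a b := by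
  have haff : ∀ x : ℝ, ∃ p q, ∀ t : ℝ, (z + ((t - s : ℝ) : ℂ) * v).im - x = p + q * t :=
    fun x => ⟨z.im - s * v.im - x, v.im, fun t => by
      simp only [Complex.add_im, Complex.im_ofReal_mul]; ring⟩
  cases e
  · refine .of_cut hab (haff (-level 1)) (fun a b i1 hab i2 h' => ?_) fun a b i1 hab i2 h1' => ?_
    all_goals
      replace h : ∀ t ∈ Icc a b, _ := fun t ht => h t ⟨i1.trans ht.1, ht.2.trans i2⟩
      clear i1 i2
    · refine straight_twist_of_mem_strip (c := 0) (by norm_num) hab h fun t ht => ?_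
      have h1 := im_mem_of_mem_heptagon_false (h t ht)
      have h2 := h' t ht
      simp only [strip, mem_ofPred_eq, dev_im, Bool.false_eq_true, if_false, zero_add]
      constructor <;> linarith [h1.1]
    refine .of_cut hab (haff (-level 2)) (fun a b i1 hab i2 h' => ?_) fun a b i1 hab i2 h' => ?_
    all_goals
      replace h : ∀ t ∈ Icc a b, _ := fun t ht => h t ⟨i1.trans ht.1, ht.2.trans i2⟩
    · refine straight_twist_of_mem_strip (c := 1) (by norm_num) hab h fun t ht => ?_
      have h1 := h1' t ⟨i1.trans ht.1, ht.2.trans i2⟩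
      have h2 := h' t ht
      simp only [strip, mem_ofPred_eq, dev_im, Bool.false_eq_true, if_false, Nat.reduceAdd]
      constructor <;> linarith
    · refine straight_twist_of_mem_strip (c := 2) (by norm_num) hab h fun t ht => ?_
      have h1 := im_mem_of_mem_heptagon_false (h t ht)
      have h2 := h' t ht
      simp only [strip, mem_ofPred_eq, dev_im, Bool.false_eq_true, if_false, Nat.reduceAdd]
      constructor <;> linarith [h1.2]
  · refine .of_cut hab (haff (level 1)) (fun a b i1 hab i2 h1' => ?_) fun a b i1 hab i2 h' => ?_
    all_goals
      replace h : ∀ t ∈ Icc a b, _ := fun t ht => h t ⟨i1.trans ht.1, ht.2.trans i2⟩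
      clear i1 i2
    rotate_left
    · refine straight_twist_of_mem_strip (c := 0) (by norm_num) hab h fun t ht => ?_
      have h1 := im_mem_of_mem_heptagon (h t ht)
      have h2 := h' t ht
      simp only [strip, mem_ofPred_eq, dev_im, if_true, zero_add]
      constructor <;> linarith [h1.2]
    refine .of_cut hab (haff (level 2)) (fun a b i1 hab i2 h' => ?_) fun a b i1 hab i2 h' => ?_
    all_goals
      replace h : ∀ t ∈ Icc a b, _ := fun t ht => h t ⟨i1.trans ht.1, ht.2.trans i2⟩
    · refine straight_twist_of_mem_strip (c := 2) (by norm_num) hab h fun t ht => ?_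
      have h1 := im_mem_of_mem_heptagon (h t ht)
      have h2 := h' t ht
      simp only [strip, mem_ofPred_eq, dev_im, if_true, Nat.reduceAdd]
      constructor <;> linarith [h1.1]
    · refine straight_twist_of_mem_strip (c := 1) (by norm_num) hab h fun t ht => ?_
      have h1 := h1' t ⟨i1.trans ht.1, ht.2.trans i2⟩
      have h2 := h' t ht
      simp only [strip, mem_ofPred_eq, dev_im, if_true, Nat.reduceAdd]
      constructor <;> linarith

lemma σ_mem_holonomy {v : ℂ} (hv : v ∈ holonomy) : σ v ∈ holonomy := by
  obtain ⟨φ, hφ⟩ := exists_lift twist twist_glue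
  refine holonomy_transport (φ := φ) (fun x => ?_) (fun e z a b hab h => ?_) hv
  · obtain ⟨e, z, hz, rfl⟩ := exists_pt x
    rw [hφ e z hz, isConePoint_twist hz]
  · exact (straight_twist hab h).congr fun t ht => hφ _ _ (h t ht)

/-! ### The inverse of the shear -/

lemma ζ_pow_six : ζ ^ 6 = ⟨-Real.cos (Real.pi / 7), Real.sin (Real.pi / 7)⟩ := by
  have h : ((6 : ℕ) * Real.pi / 7 : ℝ) = Real.pi - Real.pi / 7 := by push_cast; ring
  rw [ζ_pow, h, Real.cos_pi_sub, Real.sin_pi_sub]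

lemma σ_re (z : ℂ) : (σ z).re = z.re + α * z.im := by simp [σ]

lemma σ_im (z : ℂ) : (σ z).im = z.im := by simp [σ, -Complex.ofReal_mul]

/-- The inverse of `σ`. -/
def σInv (z : ℂ) : ℂ := z - ((α * z.im : ℝ) : ℂ)

lemma σInv_re (z : ℂ) : (σInv z).re = z.re - α * z.im := by simp [σInv]

lemma σInv_im (z : ℂ) : (σInv z).im = z.im := by simp [σInv, -Complex.ofReal_mul]

lemma σ_σInv (z : ℂ) : σ (σInv z) = z := by
  apply Complex.ext
  · rw [σ_re, σInv_re, σInv_im]; ring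
  · rw [σ_im, σInv_im]

/-- The matrix of ζ⁶σ has determinant 1 and trace −2 cos(π/7) + α sin(π/7) = 0, so its square is −1.
Stability under the inverse thus follows from stability under `ζ` and `σ`, without inverting the
twist. -/
lemma σInv_eq (v : ℂ) : σInv v = -(ζ ^ 6 * σ (ζ ^ 6 * v)) := by
  have h := sin_pi_div_seven_pos.ne'
  have h1 := Real.sin_sq_add_cos_sq (Real.pi / 7)
  apply Complex.ext
  · simp only [σInv_re, ζ_pow_six, Complex.neg_re, Complex.mul_re, σ_re, σ_im, Complex.mul_im, α,
      Real.cot_eq_cos_div_sin]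
    field_simp
    linear_combination
      (2 * v.im * Real.cos (Real.pi / 7) - v.re * Real.sin (Real.pi / 7)) * h1
  · simp only [σInv_im, ζ_pow_six, Complex.neg_im, Complex.mul_re, σ_re, σ_im, Complex.mul_im, α,
      Real.cot_eq_cos_div_sin]
    field_simp
    linear_combination (-v.im) * h1

lemma σInv_mem_holonomy {v : ℂ} (hv : v ∈ holonomy) : σInv v ∈ holonomy := by
  rw [σInv_eq]
  exact neg_mem_holonomy (ζ_pow_mul_mem_holonomy (σ_mem_holonomy (ζ_pow_mul_mem_holonomy hv 6)) 6)

/-! ### The sectors of angle `π / 7` -/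

lemma ζ_pow_re (k : ℕ) : (ζ ^ k).re = Real.cos (k * Real.pi / 7) := by rw [ζ_pow]

lemma ζ_pow_im (k : ℕ) : (ζ ^ k).im = Real.sin (k * Real.pi / 7) := by rw [ζ_pow]

lemma ζ_pow_im_pos {k : ℕ} (h1 : 1 ≤ k) (h6 : k ≤ 6) : 0 < (ζ ^ k).im := by
  have hpi := Real.pi_pos
  have h1' : (1 : ℝ) ≤ k := by exact_mod_cast h1
  have h6' : (k : ℝ) ≤ 6 := by exact_mod_cast h6
  rw [ζ_pow_im]
  apply Real.sin_pos_of_pos_of_lt_pi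
  · positivity
  · nlinarith

lemma sin_le_ζ_pow_im {k : ℕ} (h1 : 1 ≤ k) (h6 : k ≤ 6) :
    Real.sin (Real.pi / 7) ≤ (ζ ^ k).im := by
  have hpi := Real.pi_pos
  have h1' : (1 : ℝ) ≤ k := by exact_mod_cast h1
  have h6' : (k : ℝ) ≤ 6 := by exact_mod_cast h6
  rw [ζ_pow_im]
  rcases le_total (k * Real.pi / 7) (Real.pi / 2) with h | h
  · exact Real.sin_le_sin_of_le_of_le_pi_div_two (by linarith) h (by nlinarith)
  · rw [← Real.sin_pi_sub (k * Real.pi / 7)]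
    exact Real.sin_le_sin_of_le_of_le_pi_div_two (by linarith) (by linarith) (by nlinarith)

/-- The oriented area of the parallelogram spanned by two vectors. -/
def cross (u v : ℂ) : ℝ := u.re * v.im - u.im * v.re

lemma cross_ζ_pow (k : ℕ) : cross (ζ ^ k) (ζ ^ (k + 1)) = Real.sin (Real.pi / 7) := by
  have h : Real.pi / 7 = (k + 1 : ℕ) * Real.pi / 7 - k * Real.pi / 7 := by push_cast; ring
  rw [h, Real.sin_sub, cross, ζ_pow_re, ζ_pow_re, ζ_pow_im, ζ_pow_im]
  ring

/-- Multiplication by ζ⁷⁻ᵏ sends ζᵏ to −1, so the gap for heights becomes a gap transverse to the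
direction ζᵏ. -/
lemma sin_le_abs_cross {v : ℂ} (hv : v ∈ holonomy) {k : ℕ} (hk : k ≤ 7)
    (h : cross (ζ ^ k) v ≠ 0) : Real.sin (Real.pi / 7) ≤ |cross (ζ ^ k) v| := by
  have e : (ζ ^ (7 - k) * v).im = -cross (ζ ^ k) v := by
    have h1 : ((7 - k : ℕ) * Real.pi / 7 : ℝ) = Real.pi - k * Real.pi / 7 := by
      rw [Nat.cast_sub hk]; push_cast; ring
    rw [Complex.mul_im, cross, ζ_pow, ζ_pow, h1, Real.cos_pi_sub, Real.sin_pi_sub]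
    ring
  have := sin_le_abs_im_of_mem_holonomy (ζ_pow_mul_mem_holonomy hv (7 - k)) (by rw [e]; simpa)
  rwa [e, abs_neg] at this

/-- The `x`-component of `M_{b,-a} v`. -/
def xComp (a b : ℝ) (v : ℂ) : ℝ := b * v.re - a * v.im

/-- Cramer's rule for `v` in terms of `u` and `w`, under the linear form `xComp a b`. -/
lemma cross_mul_xComp (a b : ℝ) (u w v : ℂ) :
    cross u w * xComp a b v = -cross w v * xComp a b u + cross u v * xComp a b w := by
  simp only [cross, xComp]; ring

/-- A holonomy vector in the angle between `1` and `ζ ^ (n + 1)` has an `x`-component at least as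
large as one of the vectors `ζ`, …, `ζ ^ n`, or it is a multiple of `ζ ^ (n + 1)`. -/
lemma exists_xComp_le {a b : ℝ} {n : ℕ} (h1 : 1 ≤ n) (h5 : n ≤ 6)
    (hpos : ∀ k ≤ n + 1, 0 ≤ xComp a b (ζ ^ k)) {v : ℂ} (hv : v ∈ holonomy) (him : 0 < v.im)
    (hcross : cross (ζ ^ (n + 1)) v ≤ 0) :
    (∃ k, 1 ≤ k ∧ k ≤ n ∧ xComp a b (ζ ^ k) ≤ xComp a b v) ∨
      cross (ζ ^ (n + 1)) v = 0 ∧ Real.sin (Real.pi / 7) ≤ cross (ζ ^ n) v := by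
  have hs := sin_pi_div_seven_pos
  -- The least such index `j` locates `v` in the sector between `ζ ^ j` and `ζ ^ (j + 1)`; for `j =
  -- 0` the lower bound is `0 < v.im`.
  have hex : ∃ k, cross (ζ ^ (k + 1)) v ≤ 0 := ⟨n, hcross⟩
  classical
  obtain ⟨j, hj1, hj2⟩ : ∃ j, cross (ζ ^ (j + 1)) v ≤ 0 ∧ j ≤ n ∧ 0 < cross (ζ ^ j) v := by
    refine ⟨Nat.find hex, Nat.find_spec hex, Nat.find_min' hex hcross, ?_⟩
    rcases Nat.eq_zero_or_pos (Nat.find hex) with h0 | h0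
    · rw [h0]; simpa [cross] using him
    · have := Nat.find_min hex (Nat.sub_lt h0 one_pos)
      rw [Nat.sub_add_cancel (show 1 ≤ Nat.find hex from h0)] at this
      exact not_le.1 this
  have hq := sin_le_abs_cross hv (k := j) (by omega) hj2.2.ne'
  rw [abs_of_pos hj2.2] at hq
  have hF := cross_mul_xComp a b (ζ ^ j) (ζ ^ (j + 1)) v
  rw [cross_ζ_pow] at hF
  have hp0 := hpos j (by omega)
  have hp1 := hpos (j + 1) (by omega)
  -- The coordinate along `ζ ^ (j + 1)` is at least 1, which suffices for `j < n`. In the last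
  -- sector `ζ ^ (n + 1)` is not allowed, so the coordinate along `ζ ^ n` is used: it is 0 or at
  -- least 1.
  rcases hj2.1.lt_or_eq with hlt | rfl
  · refine .inl ⟨j + 1, by omega, hlt, ?_⟩
    have h2 := mul_nonneg (neg_nonneg.2 hj1) hp0
    have h3 := mul_le_mul_of_nonneg_right hq hp1
    exact le_of_mul_le_mul_left (by linarith) hs
  · rcases eq_or_ne (cross (ζ ^ (j + 1)) v) 0 with h0 | h0
    · exact .inr ⟨h0, hq⟩
    · have hp := sin_le_abs_cross hv (k := j + 1) (by omega) h0
      rw [abs_of_nonpos hj1] at hp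
      refine .inl ⟨j, h1, le_rfl, ?_⟩
      have h2 := mul_le_mul_of_nonneg_right hp hp0
      have h3 := mul_nonneg hj2.2.le hp1
      exact le_of_mul_le_mul_left (by linarith) hs

/-! ### Winners -/

/-- `v` has least slope among the vectors in the upper half-plane with the property `P`, and it is
the shortest one of that slope. -/
def Wins (P : ℂ → Prop) (v : ℂ) : Prop :=
  P v ∧ ∀ u, P u → u.re * v.im ≤ v.re * u.im ∧ (u.re * v.im = v.re * u.im → v.im ≤ u.im)

lemma Wins.unique {P : ℂ → Prop} (hP : ∀ v, P v → 0 < v.im) {v w : ℂ} (hv : Wins P v)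
    (hw : Wins P w) : v = w := by
  have h1 := hv.2 w hw.1
  have h2 := hw.2 v hv.1
  have e : w.re * v.im = v.re * w.im := le_antisymm h1.1 h2.1
  have him : v.im = w.im := le_antisymm (h1.2 e) (h2.2 e.symm)
  refine Complex.ext ?_ him
  rw [him] at e
  exact (mul_right_cancel₀ (hP w hw.1).ne' e).symm

lemma eq_smul_of_mul_eq {u v : ℂ} (hv : 0 < v.im) (h : u.re * v.im = v.re * u.im) :
    u = ((u.im / v.im : ℝ) : ℂ) * v := by
  apply Complex.ext
  · rw [Complex.re_ofReal_mul]; field_simp; linarith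
  · rw [Complex.im_ofReal_mul]; field_simp

lemma norm_le_norm_iff_of_eq_smul {v w : ℂ} {t : ℝ} (ht : 0 < t) (hw : w ≠ 0)
    (h : v = (t : ℂ) * w) : ‖w‖ ≤ ‖v‖ ↔ 1 ≤ t := by
  rw [h, norm_mul, Complex.norm_real, Real.norm_of_nonneg ht.le]
  exact le_mul_iff_one_le_left (norm_pos_iff.2 hw)

lemma ne_zero_of_im_pos {v : ℂ} (h : 0 < v.im) : v ≠ 0 := by
  rintro rfl; simp at h

lemma isLeftWinner_iff {a b : ℝ} {v : ℂ} : IsLeftWinner a b v ↔ Wins (IsLeftCandidate a b) v := by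
  refine and_congr_right fun hv => forall₂_congr fun u hu => ?_
  have hv0 := hv.2.1
  have hu0 := hu.2.1
  refine and_congr (div_le_div_iff₀ hu0 hv0) ?_
  rw [div_eq_div_iff hu0.ne' hv0.ne']
  refine imp_congr_right fun h => ?_
  rw [norm_le_norm_iff_of_eq_smul (div_pos hu0 hv0) (ne_zero_of_im_pos hv0)
    (eq_smul_of_mul_eq hv0 h), one_le_div hv0]

lemma shear_mul (a b t : ℝ) (v : ℂ) : shear a b ((t : ℂ) * v) = (t : ℂ) * shear a b v := by
  apply Complex.ext
  · simp only [shear, Complex.re_ofReal_mul, Complex.im_ofReal_mul]; ring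
  · simp only [shear, Complex.im_ofReal_mul]; ring

/-- The shear has determinant 1, so among vectors with positive x-component it preserves the order
of slopes. Vectors of equal slope are positive multiples of each other, so comparing their lengths
amounts to comparing heights. -/
lemma isWinner_iff {a b : ℝ} (hb : 0 < b) {v : ℂ} :
    IsWinner a b v ↔ Wins (IsCandidate a b) v := by
  have him : ∀ u, 0 < (shear a b u).im → 0 < u.im := fun u hu => by
    have : 0 < u.im / b := hu
    rwa [lt_div_iff₀ hb, zero_mul] at this
  refine and_congr_right fun hv => forall₂_congr fun u hu => ?_
  have hv0 := him v hv.2.1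
  have hu0 := him u hu.2.1
  have key : ∀ x y : ℂ, (shear a b x).im * (shear a b y).re - (shear a b y).im * (shear a b x).re =
      y.re * x.im - x.re * y.im := fun x y => by
    simp only [shear]
    field_simp
    ring
  have k := key v u
  rw [slope, slope, div_le_div_iff₀ hv.2.2.1 hu.2.2.1, div_eq_div_iff hv.2.2.1.ne' hu.2.2.1.ne']
  refine and_congr ⟨fun h => by linarith, fun h => by linarith⟩ ?_
  have e : (shear a b v).im * (shear a b u).re = (shear a b u).im * (shear a b v).re ↔
      u.re * v.im = v.re * u.im := ⟨fun h => by linarith, fun h => by linarith⟩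
  rw [e]
  refine imp_congr_right fun h => ?_
  rw [norm_le_norm_iff_of_eq_smul (div_pos hu0 hv0) (ne_zero_of_im_pos hv.2.1)
    ((congrArg (shear a b) (eq_smul_of_mul_eq hv0 h)).trans (shear_mul _ _ _ _)), one_le_div hv0]

/-! ### The winners are sheared powers of the rotation -/

lemma σ_ζ_pow_mem_holonomy (k : ℕ) : σ (ζ ^ k) ∈ holonomy := by
  simpa using σ_mem_holonomy (ζ_pow_mul_mem_holonomy one_mem_holonomy k)

lemma xComp_σ (a b : ℝ) (v : ℂ) : xComp a b (σ v) = xComp (a - α * b) b v := by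
  simp only [xComp, σ_re, σ_im]; ring

/-- A competitor of no larger slope, pulled back by `σInv`, falls under `exists_xComp_le`. Either
its x-component is too large for a candidate, or it is a multiple of the claimed winner. -/
lemma wins_σ_ζ_pow {a b : ℝ} {P : ℂ → Prop} (hP : ∀ v, P v → v ∈ holonomy ∧ 0 < v.im) {n : ℕ}
    (h1 : 1 ≤ n) (h5 : n ≤ 5) (hpos : ∀ k ≤ n + 1, 0 ≤ xComp a b (σ (ζ ^ k)))
    (hlt : ∀ v, P v → ∀ k, 1 ≤ k → k ≤ n → xComp a b v < xComp a b (σ (ζ ^ k)))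
    (hw : P (σ (ζ ^ (n + 1)))) : Wins P (σ (ζ ^ (n + 1))) := by
  refine ⟨hw, fun u hu => ?_⟩
  obtain ⟨hu1, hu2⟩ := hP u hu
  have hc : u.re * (σ (ζ ^ (n + 1))).im - (σ (ζ ^ (n + 1))).re * u.im =
      -cross (ζ ^ (n + 1)) (σInv u) := by
    simp only [cross, σ_re, σ_im, σInv_re, σInv_im]; ring
  rcases lt_or_ge 0 (cross (ζ ^ (n + 1)) (σInv u)) with h | h
  · exact ⟨by linarith, fun h' => by linarith⟩
  · have hmem := σInv_mem_holonomy hu1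
    simp only [xComp_σ] at hpos
    rcases exists_xComp_le h1 (by omega) hpos hmem (by rwa [σInv_im]) h with
      ⟨k, hk1, hkn, hk⟩ | ⟨h0, hq⟩
    · have := hlt u hu k hk1 hkn
      rw [← σ_σInv u, xComp_σ, xComp_σ] at this
      exact absurd hk (not_le.2 this)
    · refine ⟨by linarith, fun _ => ?_⟩
      have hs := sin_pi_div_seven_pos
      -- For a multiple of `ζ ^ (n + 1)`, the factor is its area with `ζ ^ n` divided by sin(π/7),
      -- hence at least 1.
      have h2 : cross (ζ ^ n) (ζ ^ (n + 1)) * u.im =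
          cross (ζ ^ n) (σInv u) * (ζ ^ (n + 1)).im -
            cross (ζ ^ (n + 1)) (σInv u) * (ζ ^ n).im := by
        simp only [cross, σInv_re, σInv_im]; ring
      rw [cross_ζ_pow, h0, zero_mul, sub_zero] at h2
      rw [σ_im]
      have h3 := mul_le_mul_of_nonneg_right hq (ζ_pow_im_pos (k := n + 1) (by omega) (by omega)).le
      exact le_of_mul_le_mul_left (by linarith) hs

lemma ζ_pow_im_mul_xComp (a b : ℝ) (n : ℕ) :
    (ζ ^ n).im * xComp a b (σ (ζ ^ (n + 1))) =
      (ζ ^ (n + 1)).im * xComp a b (σ (ζ ^ n)) - Real.sin (Real.pi / 7) * b := by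
  rw [← cross_ζ_pow n]
  simp only [cross, xComp, σ_re, σ_im]; ring

/-- It keeps the x-component from jumping over the window: while it is at least `b` at `n`, it is
nonnegative at `n + 1`. So the first vector to meet the upper bound is a candidate. -/
lemma le_ζ_pow_im_mul_xComp {a b : ℝ} {n : ℕ} (h1 : 1 ≤ n) (h5 : n ≤ 5)
    (hn : 0 ≤ xComp a b (σ (ζ ^ n))) :
    Real.sin (Real.pi / 7) * (xComp a b (σ (ζ ^ n)) - b) ≤
      (ζ ^ n).im * xComp a b (σ (ζ ^ (n + 1))) := by
  rw [ζ_pow_im_mul_xComp]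
  have h := mul_le_mul_of_nonneg_right (sin_le_ζ_pow_im (k := n + 1) (by omega) (by omega)) hn
  linarith

lemma xComp_σ_one (a b : ℝ) : xComp a b (σ (ζ ^ 0)) = b := by
  simp [xComp, σ_re, σ_im]

lemma isLeftWinner_of_le {a : ℝ} {n : ℕ} (h1 : 1 ≤ n) (h5 : n ≤ 5)
    (hle : ∀ k, 1 ≤ k → k ≤ n → 1 ≤ xComp a 1 (σ (ζ ^ k)))
    (hlt : xComp a 1 (σ (ζ ^ (n + 1))) < 1) : IsLeftWinner a 1 (σ (ζ ^ (n + 1))) := by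
  have hn := hle n h1 le_rfl
  have h0 : 0 ≤ xComp a 1 (σ (ζ ^ (n + 1))) := by
    have h := le_ζ_pow_im_mul_xComp h1 h5 (zero_le_one.trans hn)
    have hs := sin_pi_div_seven_pos
    have h' := mul_nonneg hs.le (sub_nonneg.2 hn)
    exact nonneg_of_mul_nonneg_right (h'.trans h) (ζ_pow_im_pos h1 (by omega))
  rw [isLeftWinner_iff]
  refine wins_σ_ζ_pow (a := a) (b := 1) (fun v hv => ⟨hv.1, hv.2.1⟩) h1 h5 (fun k hk => ?_)
    (fun v hv k hk1 hkn => ?_)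
    ⟨σ_ζ_pow_mem_holonomy _, by rw [σ_im]; exact ζ_pow_im_pos (by omega) (by omega), h0, hlt⟩
  · rcases Nat.eq_zero_or_pos k with rfl | hk0
    · rw [xComp_σ_one]; exact zero_le_one
    · rcases hk.lt_or_eq with hk | rfl
      · exact zero_le_one.trans (hle k hk0 (by omega))
      · exact h0
  · exact lt_of_lt_of_le hv.2.2.2 (hle k hk1 hkn)

lemma isWinner_of_lt {a b : ℝ} {n : ℕ} (hb : 0 < b) (hb1 : b ≤ 1) (h1 : 1 ≤ n) (h5 : n ≤ 5)
    (hlt : ∀ k, 1 ≤ k → k ≤ n → 1 < xComp a b (σ (ζ ^ k)))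
    (hle : xComp a b (σ (ζ ^ (n + 1))) ≤ 1) : IsWinner a b (σ (ζ ^ (n + 1))) := by
  have hn := hlt n h1 le_rfl
  have h0 : 0 < xComp a b (σ (ζ ^ (n + 1))) := by
    have h := le_ζ_pow_im_mul_xComp h1 h5 (zero_le_one.trans hn.le)
    have hs := sin_pi_div_seven_pos
    have h' := mul_pos hs (sub_pos.2 (hb1.trans_lt hn))
    exact pos_of_mul_pos_right (h'.trans_le h) (ζ_pow_im_pos h1 (by omega)).le
  rw [isWinner_iff hb]
  have him : 0 < (σ (ζ ^ (n + 1))).im := by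
    rw [σ_im]; exact ζ_pow_im_pos (by omega) (by omega)
  refine wins_σ_ζ_pow (a := a) (b := b) (fun v hv => ⟨hv.1, ?_⟩) h1 h5 (fun k hk => ?_)
    (fun v hv k hk1 hkn => ?_)
    ⟨σ_ζ_pow_mem_holonomy _, div_pos him hb, h0, hle⟩
  · have : 0 < v.im / b := hv.2.1
    rwa [lt_div_iff₀ hb, zero_mul] at this
  · rcases Nat.eq_zero_or_pos k with rfl | hk0
    · rw [xComp_σ_one]; exact hb.le
    · rcases hk.lt_or_eq with hk | rfl
      · exact zero_le_one.trans (hlt k hk0 (by omega)).le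
      · exact h0.le
  · exact lt_of_le_of_lt hv.2.2.2 (hlt k hk1 hkn)

lemma IsLeftWinner.unique {a b : ℝ} {v w : ℂ} (hv : IsLeftWinner a b v)
    (hw : IsLeftWinner a b w) : v = w :=
  (isLeftWinner_iff.1 hv).unique (fun _ h => h.2.1) (isLeftWinner_iff.1 hw)

lemma IsWinner.unique {a b : ℝ} (hb : 0 < b) {v w : ℂ} (hv : IsWinner a b v)
    (hw : IsWinner a b w) : v = w :=
  ((isWinner_iff hb).1 hv).unique (fun u h => by
    have : 0 < u.im / b := h.2.1
    rwa [lt_div_iff₀ hb, zero_mul] at this) ((isWinner_iff hb).1 hw)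

/-- The last index up to which a property holds. -/
lemma exists_last {Q : ℕ → Prop} (h1 : Q 1) (h6 : ¬ Q 6) :
    ∃ n, 1 ≤ n ∧ n ≤ 5 ∧ (∀ k, 1 ≤ k → k ≤ n → Q k) ∧ ¬ Q (n + 1) := by
  classical
  have hex : ∃ n, ¬ Q (n + 1) := ⟨5, h6⟩
  refine ⟨Nat.find hex, ?_, Nat.find_min' hex h6, fun k hk hkn => ?_, Nat.find_spec hex⟩
  · rw [Nat.one_le_iff_ne_zero]
    intro h0
    have := Nat.find_spec hex
    rw [h0] at this
    exact this h1
  · have := Nat.find_min hex (m := k - 1) (by omega)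
    rw [Nat.sub_add_cancel hk] at this
    exact not_not.1 this

/-! ### The transversal in terms of x-components -/

lemma α_mul_y₀ : α * y₀ = 2 * x₀ := by
  have h := sin_pi_div_seven_pos.ne'
  rw [α, y₀, x₀, Real.cot_eq_cos_div_sin]
  field_simp

lemma xComp_σ_ζ (a b : ℝ) : xComp a b (σ (ζ ^ 1)) = 3 * x₀ * b - a * y₀ := by
  have h := α_mul_y₀
  rw [xComp, σ_re, σ_im, ζ_pow_re, ζ_pow_im, Nat.cast_one, one_mul]
  change b * (x₀ + α * y₀) - a * y₀ = _
  rw [h]; ring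

lemma xComp_σ_ζ_six (a b : ℝ) : xComp a b (σ (ζ ^ 6)) = x₀ * b - a * y₀ := by
  have h := α_mul_y₀
  rw [xComp, σ_re, σ_im, ζ_pow_six]
  change b * (-x₀ + α * y₀) - a * y₀ = _
  rw [h]; ring

lemma y₀_pos : 0 < y₀ := sin_pi_div_seven_pos

lemma mem_edgeL_iff {a : ℝ} :
    a ∈ edgeL ↔ xComp a 1 (σ (ζ ^ 6)) < 1 ∧ 1 ≤ xComp a 1 (σ (ζ ^ 1)) := by
  have hy := y₀_pos
  have h := α_mul_y₀
  rw [xComp_σ_ζ, xComp_σ_ζ_six]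
  have e1 : x₀ / y₀ * 1 - 1 / y₀ = (x₀ - 1) / y₀ := by ring
  have e2 : (x₀ / y₀ + α) * 1 - 1 / y₀ = (3 * x₀ - 1) / y₀ := by
    field_simp; linear_combination h
  simp only [edgeL, OmegaL, mem_ofPred_eq, e1, e2, div_lt_iff₀ hy, le_div_iff₀ hy]
  constructor
  · rintro ⟨-, -, h1, h2⟩
    constructor <;> linarith
  · rintro ⟨h1, h2⟩
    refine ⟨one_pos, le_rfl, ?_, ?_⟩ <;> linarith

lemma mem_Omega_iff {a b : ℝ} :
    (a, b) ∈ Omega ↔ 0 < b ∧ b ≤ 1 ∧ xComp a b (σ (ζ ^ 6)) ≤ 1 ∧ 1 < xComp a b (σ (ζ ^ 1)) := by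
  have hy := y₀_pos
  have h := α_mul_y₀
  rw [xComp_σ_ζ, xComp_σ_ζ_six]
  have e1 : x₀ / y₀ * b - 1 / y₀ = (x₀ * b - 1) / y₀ := by ring
  have e2 : (x₀ / y₀ + α) * b - 1 / y₀ = (3 * x₀ * b - 1) / y₀ := by
    field_simp; linear_combination b * h
  simp only [Omega, mem_ofPred_eq, e1, e2, lt_div_iff₀ hy, div_le_iff₀ hy]
  refine and_congr_right fun _ => and_congr_right fun _ => and_congr ?_ ?_ <;>
    constructor <;> intro h' <;> linarith

lemma exists_isLeftWinner {a : ℝ} (ha : a ∈ edgeL) :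
    ∃ n, 1 ≤ n ∧ n ≤ 5 ∧ (∀ k, 1 ≤ k → k ≤ n → 1 ≤ xComp a 1 (σ (ζ ^ k))) ∧
      IsLeftWinner a 1 (σ (ζ ^ (n + 1))) := by
  obtain ⟨h6, h1⟩ := mem_edgeL_iff.1 ha
  obtain ⟨n, hn1, hn5, h, h'⟩ :=
    exists_last (Q := fun k => 1 ≤ xComp a 1 (σ (ζ ^ k))) h1 (not_le.2 h6)
  exact ⟨n, hn1, hn5, h, isLeftWinner_of_le hn1 hn5 h (not_le.1 h')⟩

lemma exists_isWinner {a b : ℝ} (h : (a, b) ∈ Omega) :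
    ∃ n, 1 ≤ n ∧ n ≤ 5 ∧ IsWinner a b (σ (ζ ^ (n + 1))) := by
  obtain ⟨hb, hb1, h6, h1⟩ := mem_Omega_iff.1 h
  obtain ⟨n, hn1, hn5, h, h'⟩ :=
    exists_last (Q := fun k => 1 < xComp a b (σ (ζ ^ k))) h1 (not_lt.2 h6)
  exact ⟨n, hn1, hn5, isWinner_of_lt hb hb1 hn1 hn5 h (not_lt.1 h')⟩

/-! ### The winning intervals -/

/-- The point of the transversal at which the vector `σ (ζ ^ k)` has `x`-component `1`. -/
def endpt (k : ℕ) : ℝ := ((σ (ζ ^ k)).re - 1) / (σ (ζ ^ k)).im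

lemma one_le_xComp_iff {a : ℝ} {k : ℕ} (h1 : 1 ≤ k) (h6 : k ≤ 6) :
    1 ≤ xComp a 1 (σ (ζ ^ k)) ↔ a ≤ endpt k := by
  have h : 0 < (σ (ζ ^ k)).im := by rw [σ_im]; exact ζ_pow_im_pos h1 h6
  rw [endpt, le_div_iff₀ h, xComp]
  constructor <;> intro h' <;> linarith

lemma one_lt_xComp_iff {a : ℝ} {k : ℕ} (h1 : 1 ≤ k) (h6 : k ≤ 6) :
    1 < xComp a 1 (σ (ζ ^ k)) ↔ a < endpt k := by
  have h : 0 < (σ (ζ ^ k)).im := by rw [σ_im]; exact ζ_pow_im_pos h1 h6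
  rw [endpt, lt_div_iff₀ h, xComp]
  constructor <;> intro h' <;> linarith

/-- This is the half-angle identity (1 − cos θ)/sin θ = tan(θ/2); it makes the order of the
thresholds visible. -/
lemma endpt_eq {k : ℕ} (h1 : 1 ≤ k) (h6 : k ≤ 6) :
    endpt k = α - Real.tan (k * Real.pi / 14) := by
  have hpos := ζ_pow_im_pos h1 h6
  rw [endpt, σ_re, σ_im, ζ_pow_re, ζ_pow_im]
  rw [ζ_pow_im] at hpos
  have e : (k * Real.pi / 7 : ℝ) = 2 * (k * Real.pi / 14) := by ring
  rw [e, Real.sin_two_mul] at hpos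
  rw [e, Real.sin_two_mul, Real.tan_eq_sin_div_cos, Real.cos_two_mul, Real.cos_sq']
  have hs : Real.sin (k * Real.pi / 14) ≠ 0 := by intro h; simp [h] at hpos
  have hc : Real.cos (k * Real.pi / 14) ≠ 0 := by intro h; simp [h] at hpos
  field_simp
  ring

lemma endpt_lt {k l : ℕ} (h1 : 1 ≤ k) (hkl : k < l) (h6 : l ≤ 6) : endpt l < endpt k := by
  have hpi := Real.pi_pos
  have h1' : (1 : ℝ) ≤ k := by exact_mod_cast h1
  have hkl' : (k : ℝ) < l := by exact_mod_cast hkl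
  have h6' : (l : ℝ) ≤ 6 := by exact_mod_cast h6
  rw [endpt_eq h1 (by omega), endpt_eq (by omega) h6]
  have := Real.tan_lt_tan_of_nonneg_of_lt_pi_div_two (x := k * Real.pi / 14)
    (y := l * Real.pi / 14) (by positivity) (by nlinarith) (by nlinarith)
  linarith

lemma endpt_le {k l : ℕ} (h1 : 1 ≤ k) (hkl : k ≤ l) (h6 : l ≤ 6) : endpt l ≤ endpt k := by
  rcases hkl.lt_or_eq with h | rfl
  · exact (endpt_lt h1 h h6).le
  · exact le_rfl

lemma mem_edgeL_of_mem_Ioc {a : ℝ} {n : ℕ} (h1 : 1 ≤ n) (h5 : n ≤ 5)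
    (ha : a ∈ Ioc (endpt (n + 1)) (endpt n)) : a ∈ edgeL := by
  rw [mem_edgeL_iff, one_le_xComp_iff le_rfl (by norm_num), ← not_le,
    one_le_xComp_iff (by norm_num) le_rfl, not_le]
  exact ⟨(endpt_le (by omega) (by omega) le_rfl).trans_lt ha.1,
    ha.2.trans (endpt_le le_rfl h1 (by omega))⟩

lemma isLeftWinner_of_mem_Ioc {a : ℝ} {n : ℕ} (h1 : 1 ≤ n) (h5 : n ≤ 5)
    (ha : a ∈ Ioc (endpt (n + 1)) (endpt n)) : IsLeftWinner a 1 (σ (ζ ^ (n + 1))) := by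
  refine isLeftWinner_of_le h1 h5 (fun k hk1 hkn => ?_) ?_
  · rw [one_le_xComp_iff hk1 (by omega)]
    exact ha.2.trans (endpt_le hk1 hkn (by omega))
  · rw [← not_le, one_le_xComp_iff (by omega) (by omega), not_le]
    exact ha.1

lemma σ_ζ_pow_injOn {n m : ℕ} (hn : n ≤ 6) (hm : m ≤ 6) (h : σ (ζ ^ n) = σ (ζ ^ m)) : n = m := by
  have hpi := Real.pi_pos
  have h1 := congrArg Complex.re h
  have h2 := congrArg Complex.im h
  rw [σ_im, σ_im] at h2
  rw [σ_re, σ_re, h2, add_left_inj, ζ_pow_re, ζ_pow_re] at h1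
  have hn' : (n : ℝ) ≤ 6 := by exact_mod_cast hn
  have hm' : (m : ℝ) ≤ 6 := by exact_mod_cast hm
  have := Real.injOn_cos ⟨by positivity, by nlinarith⟩ ⟨by positivity, by nlinarith⟩ h1
  have h3 : (n : ℝ) = m := by
    have h4 : (n : ℝ) * Real.pi = m * Real.pi := by linarith
    exact mul_right_cancel₀ hpi.ne' h4
  exact_mod_cast h3

lemma leftWinSet_σ_ζ_pow {n : ℕ} (h1 : 1 ≤ n) (h5 : n ≤ 5) :
    leftWinSet (σ (ζ ^ (n + 1))) = Ioc (endpt (n + 1)) (endpt n) := by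
  ext a
  constructor
  · rintro ⟨ha, hw⟩
    -- Winners are unique, so the index found for `a` must be `n`, and its threshold conditions give
    -- the interval.
    obtain ⟨m, hm1, hm5, hm, hw'⟩ := exists_isLeftWinner ha
    obtain rfl : n = m := by
      have := σ_ζ_pow_injOn (by omega) (by omega) (hw.unique hw')
      omega
    refine ⟨?_, (one_le_xComp_iff h1 (by omega)).1 (hm n h1 le_rfl)⟩
    rw [← not_le, ← one_le_xComp_iff (by omega) (by omega), not_le]
    exact hw.1.2.2.2
  · exact fun ha => ⟨mem_edgeL_of_mem_Ioc h1 h5 ha, isLeftWinner_of_mem_Ioc h1 h5 ha⟩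

/-- On the edge b = 1, inside the open winning interval, the left and the right conventions at
x-component 1 make no difference. -/
lemma exists_isWinner_σ_ζ_pow {n : ℕ} (h1 : 1 ≤ n) (h5 : n ≤ 5) :
    ∃ p ∈ Omega, IsWinner p.1 p.2 (σ (ζ ^ (n + 1))) := by
  obtain ⟨a, ha1, ha2⟩ := exists_between (endpt_lt h1 (Nat.lt_succ_self n) (by omega))
  refine ⟨(a, 1), mem_Omega_iff.2 ⟨one_pos, le_rfl, ?_, ?_⟩,
    isWinner_of_lt one_pos le_rfl h1 h5 (fun k hk1 hkn => ?_) ?_⟩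
  · rw [← not_lt, one_lt_xComp_iff (by norm_num) le_rfl, not_lt]
    exact (endpt_le (by omega) (by omega) le_rfl).trans ha1.le
  · rw [one_lt_xComp_iff le_rfl (by norm_num)]
    exact ha2.trans_le (endpt_le le_rfl h1 (by omega))
  · rw [one_lt_xComp_iff hk1 (by omega)]
    exact ha2.trans_le (endpt_le hk1 hkn (by omega))
  · rw [← not_lt, one_lt_xComp_iff (by omega) (by omega), not_lt]
    exact ha1.le

/-! ### The table -/

lemma α_mul_sin_two : α * Real.sin (2 * Real.pi / 7) = 2 + 2 * Real.cos (2 * Real.pi / 7) := by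
  have h := sin_pi_div_seven_pos.ne'
  have e : (2 * Real.pi / 7 : ℝ) = 2 * (Real.pi / 7) := by ring
  rw [e, Real.sin_two_mul, Real.cos_two_mul, α, Real.cot_eq_cos_div_sin]
  field_simp
  ring

lemma α_mul_sin_three :
    α * Real.sin (3 * Real.pi / 7) = 4 * Real.cos (Real.pi / 7) + 2 * Real.cos (3 * Real.pi / 7) := by
  have h := sin_pi_div_seven_pos.ne'
  have e : (3 * Real.pi / 7 : ℝ) = 3 * (Real.pi / 7) := by ring
  rw [e, Real.sin_three_mul, Real.cos_three_mul, α, Real.cot_eq_cos_div_sin]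
  field_simp
  linear_combination (-8 * Real.cos (Real.pi / 7)) * Real.sin_sq_add_cos_sq (Real.pi / 7)

lemma ζ_pow_sub {n m : ℕ} (h : n + m = 7) :
    (ζ ^ n).re = -Real.cos (m * Real.pi / 7) ∧ (ζ ^ n).im = Real.sin (m * Real.pi / 7) := by
  have e : (n * Real.pi / 7 : ℝ) = Real.pi - m * Real.pi / 7 := by
    have : (n : ℝ) = 7 - m := by
      have : ((n + m : ℕ) : ℝ) = 7 := by rw [h]; norm_num
      push_cast at this; linarith
    rw [this]; ring
  rw [ζ_pow_re, ζ_pow_im, e, Real.cos_pi_sub, Real.sin_pi_sub]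
  exact ⟨rfl, rfl⟩

/-- The index of `Fin 5` starts at 0, so wⱼ corresponds to ζʲ⁺¹. For ζ⁴, ζ⁵, ζ⁶ the table uses the
supplementary angle, which changes the sign of the cosine. -/
lemma winner_eq (i : Fin 5) : winner i = σ (ζ ^ ((i : ℕ) + 1 + 1)) := by
  have h2 := α_mul_sin_two
  have h3 := α_mul_sin_three
  fin_cases i
  · change (⟨_, _⟩ : ℂ) = σ (ζ ^ 2)
    apply Complex.ext
    · rw [σ_re, ζ_pow_re, ζ_pow_im]
      push_cast
      linarith
    · rw [σ_im, ζ_pow_im]; push_cast; rfl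
  · change (⟨_, _⟩ : ℂ) = σ (ζ ^ 3)
    apply Complex.ext
    · rw [σ_re, ζ_pow_re, ζ_pow_im]
      push_cast
      linarith
    · rw [σ_im, ζ_pow_im]; push_cast; rfl
  · obtain ⟨e1, e2⟩ := ζ_pow_sub (n := 4) (m := 3) rfl
    push_cast at e1 e2
    change (⟨_, _⟩ : ℂ) = σ (ζ ^ 4)
    apply Complex.ext
    · rw [σ_re, e1, e2]; linarith
    · rw [σ_im, e2]
  · obtain ⟨e1, e2⟩ := ζ_pow_sub (n := 5) (m := 2) rfl
    push_cast at e1 e2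
    change (⟨_, _⟩ : ℂ) = σ (ζ ^ 5)
    apply Complex.ext
    · rw [σ_re, e1, e2]; linarith
    · rw [σ_im, e2]
  · change (⟨x₀, y₀⟩ : ℂ) = σ (ζ ^ 6)
    have h := α_mul_y₀
    apply Complex.ext
    · rw [σ_re, ζ_pow_six]
      change x₀ = -x₀ + α * y₀
      linarith
    · rw [σ_im, ζ_pow_six]; rfl

lemma point_eq (i : Fin 5) : point i = endpt ((i : ℕ) + 1) := by
  have hw := winner_eq
  fin_cases i
  · have h := α_mul_y₀
    change (3 * x₀ - 1) / y₀ = endpt 1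
    rw [endpt, σ_re, σ_im, ζ_pow_re, ζ_pow_im, Nat.cast_one, one_mul]
    change _ = (x₀ + α * y₀ - 1) / y₀
    rw [h]; congr 1; ring
  · change _ = ((σ (ζ ^ ((0 : Fin 5) + 1 + 1 : ℕ))).re - 1) / (σ (ζ ^ ((0 : Fin 5) + 1 + 1 : ℕ))).im
    rw [← hw]
    change (1 + 3 * Real.cos (2 * Real.pi / 7)) / Real.sin (2 * Real.pi / 7) =
      (2 + 3 * Real.cos (2 * Real.pi / 7) - 1) / Real.sin (2 * Real.pi / 7)
    congr 1; ring
  · change _ = ((σ (ζ ^ ((1 : Fin 5) + 1 + 1 : ℕ))).re - 1) / (σ (ζ ^ ((1 : Fin 5) + 1 + 1 : ℕ))).im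
    rw [← hw]
    rfl
  · change _ = ((σ (ζ ^ ((2 : Fin 5) + 1 + 1 : ℕ))).re - 1) / (σ (ζ ^ ((2 : Fin 5) + 1 + 1 : ℕ))).im
    rw [← hw]
    rfl
  · change _ = ((σ (ζ ^ ((3 : Fin 5) + 1 + 1 : ℕ))).re - 1) / (σ (ζ ^ ((3 : Fin 5) + 1 + 1 : ℕ))).im
    rw [← hw]
    change (1 + Real.cos (2 * Real.pi / 7)) / Real.sin (2 * Real.pi / 7) =
      (2 + Real.cos (2 * Real.pi / 7) - 1) / Real.sin (2 * Real.pi / 7)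
    congr 1; ring

lemma σ_ζ_pow_mem_range_winner {n : ℕ} (h1 : 1 ≤ n) (h5 : n ≤ 5) :
    σ (ζ ^ (n + 1)) ∈ range winner :=
  ⟨⟨n - 1, by omega⟩, by rw [winner_eq]; simp only [Nat.sub_add_cancel h1]⟩

end DoubleHeptagon

end

theorem mainTheorem7 :
    (∀ i : Fin 5,
      DoubleHeptagon.point i ∈ DoubleHeptagon.edgeL ∧
      DoubleHeptagon.IsLeftWinner (DoubleHeptagon.point i) 1 (DoubleHeptagon.winner i) ∧
      DoubleHeptagon.leftWinSet (DoubleHeptagon.winner i) =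
        Set.Ioc (((DoubleHeptagon.winner i).re - 1) / (DoubleHeptagon.winner i).im)
          (DoubleHeptagon.point i)) ∧
    {v : ℂ | ∃ a ∈ DoubleHeptagon.edgeL, DoubleHeptagon.IsLeftWinner a 1 v} =
      Set.range DoubleHeptagon.winner ∧
    {v : ℂ | ∃ p ∈ DoubleHeptagon.Omega, DoubleHeptagon.IsWinner p.1 p.2 v} =
      Set.range DoubleHeptagon.winner := by
  open DoubleHeptagon in
  have hmem : ∀ i : Fin 5, point i ∈ Set.Ioc (endpt ((i : ℕ) + 1 + 1)) (endpt ((i : ℕ) + 1)) :=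
    fun i => by
      rw [point_eq]
      exact ⟨endpt_lt (by omega) (by omega) (by omega), le_rfl⟩
  open DoubleHeptagon in
  have hpt : ∀ i : Fin 5, point i ∈ edgeL ∧ IsLeftWinner (point i) 1 (winner i) := fun i => by
    rw [winner_eq]
    exact ⟨mem_edgeL_of_mem_Ioc (by omega) (by omega) (hmem i),
      isLeftWinner_of_mem_Ioc (by omega) (by omega) (hmem i)⟩
  refine ⟨fun i => ⟨(hpt i).1, (hpt i).2, ?_⟩, ?_, ?_⟩
  · rw [DoubleHeptagon.winner_eq, DoubleHeptagon.point_eq]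
    exact DoubleHeptagon.leftWinSet_σ_ζ_pow (by omega) (by omega)
  · ext v
    constructor
    · rintro ⟨a, ha, hv⟩
      obtain ⟨n, hn1, hn5, -, hw⟩ := DoubleHeptagon.exists_isLeftWinner ha
      rw [hv.unique hw]
      exact DoubleHeptagon.σ_ζ_pow_mem_range_winner hn1 hn5
    · rintro ⟨i, rfl⟩
      exact ⟨_, hpt i⟩
  · ext v
    constructor
    · rintro ⟨⟨a, b⟩, hp, hv⟩
      obtain ⟨n, hn1, hn5, hw⟩ := DoubleHeptagon.exists_isWinner hp
      rw [hv.unique hp.1 hw]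
      exact DoubleHeptagon.σ_ζ_pow_mem_range_winner hn1 hn5
    · rintro ⟨i, rfl⟩
      rw [DoubleHeptagon.winner_eq]
      exact DoubleHeptagon.exists_isWinner_σ_ζ_pow (by omega) (by omega)
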